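/- Fix a universal self-delimiting (prefix) Turing machine $U$ with one-way program tape and one-way output tape, universal meaning that it minimizes, up to an additive constant, the complexity $\mathbf K(x/y)=\min\{\|p\| : U_y(p)=x\}$, where $U_y(p)=x$ means that $U$, with auxiliary string $y$, reads exactly the $\|p\|$ bits of $p$ and halts with output $x$. Put $\mathbf m(x/y)=\sum_{p:\,U_y(p)=x}2^{-\|p\|}$. A vector or matrix is elementary if the real and imaginary parts of its entries are rational; elementary objects and natural numbers are identified with strings by a fixed computable encoding. A semi-density matrix is a positive semidefinite matrix of trace at most $1$. On the $2^n$-dimensional space of $n$ qubits let $$\boldsymbol\mu=\sum_{|\phi\rangle\ \text{elementary unit vector}}\mathbf m(|\phi\rangle/n)\,|\phi\rangle\langle\phi| .$$ A program $q$ lower computes a matrix $E$ if $U$ on $q$ (with empty auxiliary string) reads at most $\|q\|$ bits and prints, with or without halting, a nonempty finite or infinite sequence of elementary positive semidefinite matrices $E_1\le E_2\le\cdots$ (in the positive semidefinite order) with limit $E$ (with last member $E$ if the sequence is finite). Put $\underline{\mathbf m}(E/n)=\sum\{\mathbf m(q/n) : q \text{ lower computes } E\}$, let $\mathcal C$ be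 the set of all lower computable matrices $E=A\otimes B$, with $A,B$ of size $2^n\times 2^n$, such that $\operatorname{Tr}E(\boldsymbol\mu\otimes\boldsymbol\mu)\le 1$, and put $$\mathfrak C=\sum_{E\in\mathcal C}\underline{\mathbf m}(E/n)\,E,\qquad \mathbf I(\rho:\sigma)=\log_2\operatorname{Tr}\mathfrak C(\rho\otimes\sigma),$$ with $\log_2 0=-\infty$. Then for every $n$ the series that define $\boldsymbol\mu$ and $\mathfrak C$ converge, and there is a constant $c$, depending only on $U$, such that for all $n$ and all elementary semi-density matrices $\rho,\sigma$ on $n$ qubits $$\mathbf I(\rho:\sigma)\le \mathbf K(\rho/n)+\mathbf K(\sigma/n)+c .$$ -/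

import Mathlib

open scoped ComplexOrder Kronecker ENNReal

noncomputable section

/-! ### Self-delimiting machines -/

/-- A deterministic machine with a one-way read-only program tape, an auxiliary string that is
available from the start, and a one-way write-only output tape.  A configuration (control state,
contents of the work and auxiliary tapes) ranges over a coded countable type, and the elementary
operations on configurations are computable.  Turing machines are of this form, and machines of
this form compute nothing beyond what Turing machines compute. -/
structure PrefixMachine where
  /-- internal configurations -/
  Cfg : Type
  [primcodable : Primcodable Cfg]
  /-- the starting configuration for a given auxiliary string -/
  init : List Bool → Cfg
  /-- whether a configuration is a halting one -/
  halts : Cfg → Bool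
  /-- whether the next step reads a bit from the program tape -/
  reads : Cfg → Bool
  /-- the bits appended to the output tape by the next step -/
  write : Cfg → List Bool
  /-- the next configuration, given the bit that was read, if any -/
  next : Cfg → Option Bool → Cfg
  init_computable : Computable init
  halts_computable : Computable halts
  reads_computable : Computable reads
  write_computable : Computable write
  next_computable : Computable₂ next

namespace PrefixMachine

/-- One step on a triple (configuration, unread part of the program, output so far).  A machine
that has halted, or that asks for a bit when none is left, stays where it is. -/
def step (U : PrefixMachine) (s : U.Cfg × List Bool × List Bool) :
    U.Cfg × List Bool × List Bool :=
  if U.halts s.1 then s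
  else if U.reads s.1 then
    match s.2.1 with
    | [] => s
    | b :: rest => (U.next s.1 (some b), rest, s.2.2 ++ U.write s.1)
  else (U.next s.1 none, s.2.1, s.2.2 ++ U.write s.1)

/-- The situation after `t` steps with auxiliary string `y` and program `p`. -/
def run (U : PrefixMachine) (y p : List Bool) (t : ℕ) : U.Cfg × List Bool × List Bool :=
  U.step^[t] (U.init y, p, [])

/-- `U_y(p) = x`: the machine reads all the bits of `p`, asks for no further one, and halts with
output `x`. -/
def Outputs (U : PrefixMachine) (y p x : List Bool) : Prop :=
  ∃ t, U.halts (U.run y p t).1 = true ∧ (U.run y p t).2.1 = [] ∧ (U.run y p t).2.2 = x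

/-- The conditional complexity `K(x / y)`, the least length of a program for `x` given `y`
(`⊤` if there is none). -/
def K (U : PrefixMachine) (x y : List Bool) : ℕ∞ :=
  ⨅ p : {p : List Bool // U.Outputs y p x}, (p.1.length : ℕ∞)

/-- The conditional algorithmic probability `m(x / y)`. -/
def m (U : PrefixMachine) (x y : List Bool) : ℝ≥0∞ :=
  ∑' p : {p : List Bool // U.Outputs y p x}, (2⁻¹ : ℝ≥0∞) ^ p.1.length

/-- A machine is universal if it minimizes `K`, up to an additive constant. -/
def IsUniversal (U : PrefixMachine) : Prop :=
  ∀ V : PrefixMachine, ∃ c : ℕ, ∀ x y : List Bool, U.K x y ≤ V.K x y + c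

/-- With empty auxiliary string and program `q` on its tape, the machine never asks for more than
the `‖q‖` bits of `q`. -/
def ReadsWithin (U : PrefixMachine) (q : List Bool) : Prop :=
  ∀ t, ¬ (U.halts (U.run [] q t).1 = false ∧ U.reads (U.run [] q t).1 = true ∧
    (U.run [] q t).2.1 = [])

/-- With empty auxiliary string and program `q`, what appears on the output tape in the course of
the whole run, halting or not, is exactly `w 0`, `w 1`, ..., one after the other, for all indices
smaller than `L` (all indices if `L = ⊤`). -/
def Prints (U : PrefixMachine) (q : List Bool) (L : ℕ∞) (w : ℕ → List Bool) : Prop :=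
  (∀ t, ∃ k : ℕ, (k : ℕ∞) ≤ L ∧ (U.run [] q t).2.2 <+: ((List.range k).map w).flatten) ∧
  (∀ k : ℕ, (k : ℕ∞) ≤ L → ∃ t, ((List.range k).map w).flatten <+: (U.run [] q t).2.2)

end PrefixMachine

/-! ### Elementary objects and their encodings -/

/-- Gaussian rationals, as pairs (real part, imaginary part). -/
abbrev GaussRat := ℚ × ℚ

/-- The complex number given by a Gaussian rational. -/
def GaussRat.toComplex (z : GaussRat) : ℂ := ⟨(z.1 : ℝ), (z.2 : ℝ)⟩

/-- The complex matrix given by a matrix of Gaussian rationals. -/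
def toC {d : ℕ} (A : Matrix (Fin d) (Fin d) GaussRat) : Matrix (Fin d) (Fin d) ℂ :=
  A.map GaussRat.toComplex

/-- Self-delimiting encoding of natural numbers by strings.  (Any two computably equivalent
encodings give complexities that differ by at most an additive constant.) -/
def natStr (k : ℕ) : List Bool := List.replicate k true ++ [false]

/-- Numbering of the rationals by numerator and denominator. -/
def ratCode (q : ℚ) : ℕ := Nat.pair (Encodable.encode q.num) q.den

/-- Numbering of the Gaussian rationals. -/
def gaussCode (z : GaussRat) : ℕ := Nat.pair (ratCode z.1) (ratCode z.2)

/-- The string encoding a vector of Gaussian rationals: the list of its components. -/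
def vecStr {d : ℕ} (v : Fin d → GaussRat) : List Bool :=
  natStr (Encodable.encode (List.ofFn fun i => gaussCode (v i)))

/-- The string encoding a matrix of Gaussian rationals: the list of its rows. -/
def matStr {d : ℕ} (A : Matrix (Fin d) (Fin d) GaussRat) : List Bool :=
  natStr (Encodable.encode (List.ofFn fun i => List.ofFn fun j => gaussCode (A i j)))

/-! ### Quantum states -/

/-- Semi-density matrices: positive semidefinite (in particular self-adjoint) of trace at
most `1`. -/
def IsSemiDensity {d : ℕ} (ρ : Matrix (Fin d) (Fin d) ℂ) : Prop :=
  ρ.PosSemidef ∧ ρ.trace.re ≤ 1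

/-- The elementary pure states of `n` qubits: unit vectors of length `2 ^ n` whose components are
Gaussian rationals. -/
def ElemPure (n : ℕ) : Type :=
  {v : Fin (2 ^ n) → GaussRat // ∑ i, ((v i).1 ^ 2 + (v i).2 ^ 2) = 1}

/-- The projection `|φ⟩⟨φ|`. -/
def ElemPure.proj {n : ℕ} (φ : ElemPure n) : Matrix (Fin (2 ^ n)) (Fin (2 ^ n)) ℂ :=
  Matrix.vecMulVec (fun i => (φ.1 i).toComplex) (star fun i => (φ.1 i).toComplex)

/-- The Kronecker product of two square matrices of the same size, with its usual ordering of rows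
and columns. -/
def kron {d : ℕ} (A B : Matrix (Fin d) (Fin d) ℂ) : Matrix (Fin (d * d)) (Fin (d * d)) ℂ :=
  Matrix.reindex finProdFinEquiv finProdFinEquiv (A ⊗ₖ B)

namespace PrefixMachine

/-- The summand `m(|φ⟩ / n) |φ⟩⟨φ|` of the universal matrix. -/
def muTerm (U : PrefixMachine) (n : ℕ) (φ : ElemPure n) :
    Matrix (Fin (2 ^ n)) (Fin (2 ^ n)) ℂ :=
  (U.m (vecStr φ.1) (natStr n)).toReal • φ.proj

/-- The universal semi-density matrix `μ` on `n` qubits. -/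
def mu (U : PrefixMachine) (n : ℕ) : Matrix (Fin (2 ^ n)) (Fin (2 ^ n)) ℂ :=
  ∑' φ : ElemPure n, U.muTerm n φ

/-- Program `q` lower computes `σ`: on `q` the machine reads at most `‖q‖` bits and prints, with or
without halting, a nonempty finite or infinite sequence of `L` elementary positive semidefinite
matrices that increases to `σ`.  (A finite sequence is continued by repeating its last member.) -/
def LowerComputes (U : PrefixMachine) {d : ℕ} (q : List Bool)
    (σ : Matrix (Fin d) (Fin d) ℂ) : Prop :=
  U.ReadsWithin q ∧
  ∃ (L : ℕ∞) (s : ℕ → Matrix (Fin d) (Fin d) GaussRat),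
    1 ≤ L ∧ U.Prints q L (fun i => matStr (s i)) ∧
    (∀ i : ℕ, L ≤ ((i + 1 : ℕ) : ℕ∞) → s (i + 1) = s i) ∧
    (∀ i, (toC (s i)).PosSemidef) ∧
    (∀ i, (toC (s (i + 1)) - toC (s i)).PosSemidef) ∧
    Filter.Tendsto (fun i => toC (s i)) Filter.atTop (nhds σ)

/-- The lower algorithmic probability of `σ` given `y`: the sum of `m(q / y)` over all programs `q`
that lower compute `σ`. -/
def lowerM (U : PrefixMachine) {d : ℕ} (σ : Matrix (Fin d) (Fin d) ℂ) (y : List Bool) : ℝ≥0∞ :=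
  ∑' q : {q : List Bool // U.LowerComputes q σ}, U.m q.1 y

/-- The product tests for `C ⊗ D`: the lower computable matrices `E` of the form `A ⊗ B` with
`Tr E (C ⊗ D) ≤ 1`. -/
def ProductTests (U : PrefixMachine) {d : ℕ} (C D : Matrix (Fin d) (Fin d) ℂ) :
    Set (Matrix (Fin (d * d)) (Fin (d * d)) ℂ) :=
  {E | (∃ A B : Matrix (Fin d) (Fin d) ℂ, E = kron A B) ∧ (∃ q, U.LowerComputes q E) ∧
    (E * kron C D).trace.re ≤ 1}

/-- The summand of the universal product test for `μ ⊗ μ` that belongs to the test `E`. -/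
def testTerm (U : PrefixMachine) (n : ℕ) (E : U.ProductTests (U.mu n) (U.mu n)) :
    Matrix (Fin (2 ^ n * 2 ^ n)) (Fin (2 ^ n * 2 ^ n)) ℂ :=
  (U.lowerM E.1 (natStr n)).toReal • E.1

/-- The universal product test for `μ ⊗ μ`. -/
def universalTest (U : PrefixMachine) (n : ℕ) :
    Matrix (Fin (2 ^ n * 2 ^ n)) (Fin (2 ^ n * 2 ^ n)) ℂ :=
  ∑' E : U.ProductTests (U.mu n) (U.mu n), U.testTerm n E

end PrefixMachine

/-- The binary logarithm of a nonnegative real, with `log 0 = -∞`. -/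
def log2 (x : ℝ) : EReal := if x ≤ 0 then ⊥ else ((Real.logb 2 x : ℝ) : EReal)

/-- The mutual information `I(σ : ρ)` of two semi-density matrices on `n` qubits. -/
def PrefixMachine.I (U : PrefixMachine) (n : ℕ) (σ ρ : Matrix (Fin (2 ^ n)) (Fin (2 ^ n)) ℂ) :
    EReal :=
  log2 (U.universalTest n * kron σ ρ).trace.re

end

noncomputable section

/-! ### Primitive recursive arithmetic of integers and rationals -/

section Arithmetic

open Encodable

/-! The core is a domination property (`PrefixMachine.IsUniversal.exists_mu_dominates`): every
elementary semi-density matrix satisfies ρ ≤ a μ with a = 40 · 2^(K(ρ/n) + c). If also σ ≤ b μ, then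
Tr E(ρ ⊗ σ) ≤ ab Tr E(μ ⊗ μ) ≤ ab for every test E, by positivity. A program lower computes at most
one matrix, so Kraft's inequality makes the weights of the tests sum to at most 1. Hence the
universal test has value at most ab on ρ ⊗ σ (`trace_universalTest_le`), and taking logarithms
finishes.

Domination is a coding argument, with the difficulty that the eigenvectors of ρ, and even the
normalizations of Gaussian rational vectors, need not be elementary. Repeated Schur complements
avoid square roots and write ρ as a nonnegative rational combination of matrices |v⟩⟨v| with v
Gaussian rational. Each v is shifted along the first basis vector until its norm is rational
(`exists_rational_norm`). This costs a constant factor and gives a mixture of elementary pure states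
of total weight at most 10 above ρ (`exists_mixture_dominating`). A prefix code then gives each
state φ of the mixture a codeword of length ℓ with weight at most 40 · 2^(-ℓ).

The machine `split` runs a program for ρ, finds such a table by search, reads a codeword and prints
its vector. Universality gives K(φ/n) ≤ K(ρ/n) + ℓ + c, so μ contains each φ with weight at least
2^(-K(ρ/n) - ℓ - c); summing over the table gives domination. To keep the search within rational
arithmetic, a table comes with a rank-one expansion of its excess over ρ, and checking this
`Certificate` is primitive recursive.

For convergence, Kraft's inequality handles μ. Since μ dominates the maximally mixed state, μ ≥ ε ·
1 with ε > 0, so for fixed n all tests have bounded trace and hence bounded entries. -/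

theorem primrec_nat_gcd : Primrec₂ Nat.gcd := by
  -- Euclid's step, idle once the first component is 0. That component strictly decreases until
  -- then, so as many steps as its initial value suffice.
  let stp : ℕ × ℕ → ℕ × ℕ := fun q => if q.1 = 0 then q else (q.2 % q.1, q.1)
  have key : ∀ k a b : ℕ, a ≤ k → (stp^[k] (a, b)) = (0, Nat.gcd a b) := by
    intro k
    induction k with
    | zero => intro a b h; simp [Nat.le_zero.1 h]
    | succ k ih =>
      intro a b h
      rw [Function.iterate_succ_apply]
      rcases Nat.eq_zero_or_pos a with rfl | ha
      · have : stp (0, b) = (0, b) := by simp [stp]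
        rw [this, ih 0 b (Nat.zero_le _)]
      · have : stp (a, b) = (b % a, a) := by simp [stp, ha.ne']
        rw [this, ih _ _ (by have := Nat.mod_lt b ha; omega), ← Nat.gcd_rec]
  have hstp : Primrec stp :=
    Primrec.ite (Primrec.eq.comp Primrec.fst (Primrec.const 0)) Primrec.id
      (Primrec.pair (Primrec.nat_mod.comp Primrec.snd Primrec.fst) Primrec.fst)
  have : Primrec fun p : ℕ × ℕ => (stp^[p.1] p).2 :=
    Primrec.snd.comp (Primrec.nat_iterate Primrec.fst Primrec.id
      (hstp.comp Primrec.snd).to₂)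
  exact this.of_eq fun p => by rw [key p.1 p.1 p.2 le_rfl]

/-! ### Integers, through their positive and negative parts -/

theorem encode_int_ofNat (n : ℕ) : encode (n : ℤ) = 2 * n := rfl

theorem encode_int_negSucc (n : ℕ) : encode (Int.negSucc n) = 2 * n + 1 := rfl

theorem primrec_int_ofNat : Primrec (fun n : ℕ => (n : ℤ)) :=
  Primrec.encode_iff.1 (Primrec.nat_double.of_eq fun _ => rfl)

theorem primrec_int_negSucc : Primrec Int.negSucc :=
  Primrec.encode_iff.1 (Primrec.nat_double_succ.of_eq fun _ => rfl)

theorem primrec_int_toNat : Primrec Int.toNat := by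
  have : Primrec fun z : ℤ => cond (encode z).bodd 0 (encode z).div2 :=
    Primrec.cond (Primrec.nat_bodd.comp Primrec.encode) (Primrec.const 0)
      (Primrec.nat_div2.comp Primrec.encode)
  refine this.of_eq fun z => ?_
  rcases z with n | n
  · have := encode_int_ofNat n
    simp only [Int.ofNat_eq_natCast, this]
    simp [Nat.div2_val]
  · rw [encode_int_negSucc]; simp

theorem primrec_int_neg_toNat : Primrec (fun z : ℤ => (-z).toNat) := by
  have : Primrec fun z : ℤ => cond (encode z).bodd ((encode z).div2 + 1) 0 :=
    Primrec.cond (Primrec.nat_bodd.comp Primrec.encode)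
      (Primrec.succ.comp (Primrec.nat_div2.comp Primrec.encode)) (Primrec.const 0)
  refine this.of_eq fun z => ?_
  rcases z with n | n
  · have := encode_int_ofNat n
    simp only [Int.ofNat_eq_natCast, this]
    simp
  · rw [encode_int_negSucc]
    simp [Nat.div2_val]

theorem primrec_subNatNat : Primrec₂ (fun m n : ℕ => (m : ℤ) - n) := by
  have : Primrec fun p : ℕ × ℕ =>
      if p.2 ≤ p.1 then ((p.1 - p.2 : ℕ) : ℤ) else Int.negSucc (p.2 - p.1 - 1) :=
    Primrec.ite (c := fun p : ℕ × ℕ => p.2 ≤ p.1) (Primrec.nat_le.comp Primrec.snd Primrec.fst)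
      (primrec_int_ofNat.comp (Primrec.nat_sub.comp Primrec.fst Primrec.snd))
      (primrec_int_negSucc.comp (Primrec.pred.comp
        ((Primrec.nat_sub.comp Primrec.snd Primrec.fst).of_eq fun p : ℕ × ℕ => rfl)))
  refine this.of_eq fun p => ?_
  split_ifs with h
  · push_cast [h]; rfl
  · change _ = (p.1 : ℤ) - p.2
    rw [Int.negSucc_eq]; omega

theorem primrec_int_of_parts {α : Type*} [Primcodable α] {f g : α → ℕ} (hf : Primrec f)
    (hg : Primrec g) : Primrec fun a => (f a : ℤ) - g a :=
  primrec_subNatNat.comp hf hg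

theorem primrec_int_add : Primrec₂ (fun x y : ℤ => x + y) := by
  have hp := primrec_int_toNat
  have hn := primrec_int_neg_toNat
  refine (primrec_int_of_parts
    (Primrec.nat_add.comp (hp.comp Primrec.fst) (hp.comp Primrec.snd))
    (Primrec.nat_add.comp (hn.comp Primrec.fst) (hn.comp Primrec.snd))).of_eq fun p => ?_
  have h1 := Int.toNat_sub_toNat_neg p.1
  have h2 := Int.toNat_sub_toNat_neg p.2
  change _ = p.1 + p.2
  omega

theorem primrec_int_mul : Primrec₂ (fun x y : ℤ => x * y) := by
  have hp := primrec_int_toNat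
  have hn := primrec_int_neg_toNat
  refine (primrec_int_of_parts
    (Primrec.nat_add.comp (Primrec.nat_mul.comp (hp.comp Primrec.fst) (hp.comp Primrec.snd))
      (Primrec.nat_mul.comp (hn.comp Primrec.fst) (hn.comp Primrec.snd)))
    (Primrec.nat_add.comp (Primrec.nat_mul.comp (hp.comp Primrec.fst) (hn.comp Primrec.snd))
      (Primrec.nat_mul.comp (hn.comp Primrec.fst) (hp.comp Primrec.snd)))).of_eq fun p => ?_
  push_cast
  have h1 := Int.toNat_sub_toNat_neg p.1
  have h2 := Int.toNat_sub_toNat_neg p.2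
  conv_rhs => rw [← h1, ← h2]
  ring

theorem primrec_int_neg : Primrec (fun x : ℤ => -x) :=
  (primrec_int_of_parts primrec_int_neg_toNat primrec_int_toNat).of_eq fun z => by
    have := Int.toNat_sub_toNat_neg z
    omega

theorem primrec_int_natAbs : Primrec Int.natAbs :=
  (Primrec.nat_add.comp primrec_int_toNat primrec_int_neg_toNat).of_eq fun z => by
    omega

/-- This is the reduced numerator in `mkRat`. The gcd divides `z`, so the floor division is exact
and can be done on the two parts separately. -/
theorem primrec_int_div_natAbs_gcd :
    Primrec₂ (fun (z : ℤ) (d : ℕ) => z / (Nat.gcd d z.natAbs : ℤ)) := by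
  have hg : Primrec fun p : ℤ × ℕ => Nat.gcd p.2 p.1.natAbs :=
    primrec_nat_gcd.comp Primrec.snd (primrec_int_natAbs.comp Primrec.fst)
  refine (primrec_int_of_parts
    (Primrec.nat_div.comp (primrec_int_toNat.comp Primrec.fst) hg)
    (Primrec.nat_div.comp (primrec_int_neg_toNat.comp Primrec.fst) hg)).of_eq fun p => ?_
  obtain ⟨z, d⟩ := p
  obtain ⟨n, rfl | rfl⟩ := z.eq_nat_or_neg
  · simp
  · have : ((d.gcd n : ℕ) : ℤ) ∣ (n : ℤ) := Int.natCast_dvd_natCast.2 (Nat.gcd_dvd_right d n)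
    simp [Int.neg_ediv_of_dvd this]

/-- The pairs (numerator, denominator) of rationals in lowest terms. -/
def IsLowestTerms (p : ℤ × ℕ) : Prop := p.2 ≠ 0 ∧ Nat.gcd p.1.natAbs p.2 = 1

instance : DecidablePred IsLowestTerms := fun p =>
  inferInstanceAs (Decidable (p.2 ≠ 0 ∧ Nat.gcd p.1.natAbs p.2 = 1))

theorem primrecPred_isLowestTerms : PrimrecPred IsLowestTerms :=
  (PrimrecPred.not (Primrec.eq.comp Primrec.snd (Primrec.const 0))).and
    (Primrec.eq.comp (primrec_nat_gcd.comp (primrec_int_natAbs.comp Primrec.fst) Primrec.snd)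
      (Primrec.const 1))

instance : Primcodable (Subtype IsLowestTerms) := Primcodable.subtype primrecPred_isLowestTerms

/-- Rationals as reduced pairs. -/
def ratEquivLowestTerms : ℚ ≃ Subtype IsLowestTerms where
  toFun q := ⟨(q.num, q.den), q.den_nz, q.reduced⟩
  invFun p := ⟨p.1.1, p.1.2, p.2.1, p.2.2⟩
  left_inv _ := rfl
  right_inv _ := rfl

/-- The resulting code of a rational is `ratCode` by definition, which ties the primitive recursive
structure to the strings used in the theorem. Later encodings and decodings name this structure
explicitly. -/
instance ratPrimcodable : Primcodable ℚ := Primcodable.ofEquiv _ ratEquivLowestTerms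

theorem primrec_rat_iff {α : Type*} [Primcodable α] {f : α → ℚ} :
    Primrec f ↔ Primrec (fun a => ((f a).num, (f a).den)) := by
  rw [← Primrec.of_equiv_iff ratEquivLowestTerms,
    ← Primrec.subtype_val_iff (hp := primrecPred_isLowestTerms)]
  rfl

theorem primrec_rat_num : Primrec Rat.num := Primrec.fst.comp (primrec_rat_iff.1 Primrec.id)

theorem primrec_rat_den : Primrec Rat.den := Primrec.snd.comp (primrec_rat_iff.1 Primrec.id)

theorem primrec_mkRat : Primrec₂ mkRat := by
  refine primrec_rat_iff.2 (Primrec.pair ?_ ?_)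
  · refine (Primrec.ite (c := fun p : ℤ × ℕ => p.2 = 0)
      (Primrec.eq.comp Primrec.snd (Primrec.const 0)) (Primrec.const 0)
      (primrec_int_div_natAbs_gcd.comp Primrec.fst Primrec.snd)).of_eq fun p => ?_
    rw [Rat.num_mkRat]
  · refine (Primrec.ite (c := fun p : ℤ × ℕ => p.2 = 0)
      (Primrec.eq.comp Primrec.snd (Primrec.const 0)) (Primrec.const 1)
      (Primrec.nat_div.comp Primrec.snd
        (primrec_nat_gcd.comp Primrec.snd (primrec_int_natAbs.comp Primrec.fst)))).of_eq fun p => ?_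
    rw [Rat.den_mkRat]

theorem primrec_rat_add : Primrec₂ (fun x y : ℚ => x + y) := by
  have hn := primrec_rat_num
  have hd := primrec_int_ofNat.comp primrec_rat_den
  refine (primrec_mkRat.comp
    (primrec_int_add.comp
      (primrec_int_mul.comp (hn.comp Primrec.fst) (hd.comp Primrec.snd))
      (primrec_int_mul.comp (hn.comp Primrec.snd) (hd.comp Primrec.fst)))
    (Primrec.nat_mul.comp (primrec_rat_den.comp Primrec.fst)
      (primrec_rat_den.comp Primrec.snd))).of_eq fun p => ?_
  exact (Rat.add_def' p.1 p.2).symm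

theorem primrec_rat_mul : Primrec₂ (fun x y : ℚ => x * y) := by
  have hn := primrec_rat_num
  refine (primrec_mkRat.comp
    (primrec_int_mul.comp (hn.comp Primrec.fst) (hn.comp Primrec.snd))
    (Primrec.nat_mul.comp (primrec_rat_den.comp Primrec.fst)
      (primrec_rat_den.comp Primrec.snd))).of_eq fun p => ?_
  exact (Rat.mul_def' p.1 p.2).symm

theorem primrec_rat_neg : Primrec (fun x : ℚ => -x) :=
  primrec_rat_iff.2 ((Primrec.pair (primrec_int_neg.comp primrec_rat_num) primrec_rat_den).of_eq
    fun _ => rfl)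

theorem primrecPred_rat_nonneg : PrimrecPred (fun x : ℚ => 0 ≤ x) :=
  (Primrec.eq.comp (primrec_int_neg_toNat.comp primrec_rat_num) (Primrec.const 0)).of_eq
    fun q => by rw [← Rat.num_nonneg]; omega

theorem primrec_two_inv_pow : Primrec (fun n : ℕ => (1 / 2 : ℚ) ^ n) :=
  (Primrec.nat_rec₁ (f := fun _ x => x * (1 / 2 : ℚ)) (1 : ℚ)
    (primrec_rat_mul.comp Primrec.snd (Primrec.const _)).to₂).of_eq fun n => by
      induction n with
      | zero => exact (pow_zero _).symm
      | succ n ih => rw [pow_succ, ← ih]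

end Arithmetic

end

noncomputable section

/-! ### Certificates that a mixture of elementary pure states dominates a matrix -/

section Certificates

open Encodable

theorem PrimrecRel.forall_lt_nat {α : Type*} [Primcodable α] {R : ℕ → α → Prop}
    (hR : PrimrecRel R) : PrimrecRel fun (n : ℕ) (a : α) => ∀ i < n, R i a :=
  (hR.forall_mem_list.comp (Primrec.list_range.comp Primrec.fst) Primrec.snd).of_eq
    fun p => by simp

/-- The product `z * conj w` of Gaussian rationals. -/
def GaussRat.mulConj (z w : GaussRat) : GaussRat :=
  (z.1 * w.1 + z.2 * w.2, z.2 * w.1 + -(z.1 * w.2))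

theorem GaussRat.toComplex_mulConj (z w : GaussRat) :
    (z.mulConj w).toComplex = z.toComplex * star w.toComplex := by
  apply Complex.ext
  · simp [GaussRat.mulConj, GaussRat.toComplex]
  · simp [GaussRat.mulConj, GaussRat.toComplex]
    ring

theorem GaussRat.toComplex_add (z w : GaussRat) :
    GaussRat.toComplex (z + w) = z.toComplex + w.toComplex := by
  apply Complex.ext <;> simp [GaussRat.toComplex]

theorem GaussRat.toComplex_injective : Function.Injective GaussRat.toComplex := by
  intro z w h
  have h1 := congrArg Complex.re h
  have h2 := congrArg Complex.im h
  simp only [GaussRat.toComplex, Rat.cast_inj] at h1 h2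
  exact Prod.ext h1 h2

theorem primrec_mulConj : Primrec₂ GaussRat.mulConj := by
  have h11 := (Primrec.fst (α := ℚ) (β := ℚ)).comp (Primrec.fst (α := GaussRat) (β := GaussRat))
  have h12 := (Primrec.snd (α := ℚ) (β := ℚ)).comp (Primrec.fst (α := GaussRat) (β := GaussRat))
  have h21 := (Primrec.fst (α := ℚ) (β := ℚ)).comp (Primrec.snd (α := GaussRat) (β := GaussRat))
  have h22 := (Primrec.snd (α := ℚ) (β := ℚ)).comp (Primrec.snd (α := GaussRat) (β := GaussRat))
  exact Primrec.pair
    (primrec_rat_add.comp (primrec_rat_mul.comp h11 h21) (primrec_rat_mul.comp h12 h22))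
    (primrec_rat_add.comp (primrec_rat_mul.comp h12 h21)
      (primrec_rat_neg.comp (primrec_rat_mul.comp h11 h22)))

/-- The scaling of a Gaussian rational by a rational. -/
def GaussRat.scale (c : ℚ) (z : GaussRat) : GaussRat := (c * z.1, c * z.2)

theorem GaussRat.toComplex_scale (c : ℚ) (z : GaussRat) :
    (GaussRat.scale c z).toComplex = (c : ℝ) • z.toComplex := by
  apply Complex.ext <;> simp [GaussRat.scale, GaussRat.toComplex]

theorem primrec_scale : Primrec₂ GaussRat.scale :=
  Primrec.pair (primrec_rat_mul.comp Primrec.fst (Primrec.fst.comp Primrec.snd))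
    (primrec_rat_mul.comp Primrec.fst (Primrec.snd.comp Primrec.snd))

theorem primrec_gauss_add : Primrec₂ (fun z w : GaussRat => z + w) :=
  Primrec.pair
    (primrec_rat_add.comp (Primrec.fst.comp Primrec.fst) (Primrec.fst.comp Primrec.snd))
    (primrec_rat_add.comp (Primrec.snd.comp Primrec.fst) (Primrec.snd.comp Primrec.snd))

/-- The `(i, j)` entry of a weighted sum of projections `c * |v⟩⟨v|`. -/
def gramEntry (L : List (ℚ × List GaussRat)) (i j : ℕ) : GaussRat :=
  (L.map fun e => GaussRat.scale e.1 ((e.2.getD i 0).mulConj (e.2.getD j 0))).sum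

theorem primrec_gramEntry : Primrec fun p : List (ℚ × List GaussRat) × ℕ × ℕ =>
    gramEntry p.1 p.2.1 p.2.2 := by
  have hterm : Primrec₂ fun (p : List (ℚ × List GaussRat) × ℕ × ℕ) (e : ℚ × List GaussRat) =>
      GaussRat.scale e.1 ((e.2.getD p.2.1 0).mulConj (e.2.getD p.2.2 0)) :=
    primrec_scale.comp (Primrec.fst.comp Primrec.snd)
      (primrec_mulConj.comp
        ((Primrec.list_getD (0 : GaussRat)).comp (Primrec.snd.comp Primrec.snd)
          (Primrec.fst.comp (Primrec.snd.comp Primrec.fst)))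
        ((Primrec.list_getD (0 : GaussRat)).comp (Primrec.snd.comp Primrec.snd)
          (Primrec.snd.comp (Primrec.snd.comp Primrec.fst))))
  exact Primrec.list_foldr (f := fun p : List (ℚ × List GaussRat) × ℕ × ℕ =>
    p.1.map fun e => GaussRat.scale e.1 ((e.2.getD p.2.1 0).mulConj (e.2.getD p.2.2 0)))
    (Primrec.list_map Primrec.fst hterm) (Primrec.const 0)
    (primrec_gauss_add.comp (Primrec.fst.comp Primrec.snd) (Primrec.snd.comp Primrec.snd)).to₂

theorem Primrec.gramEntry {α : Type*} [Primcodable α] {L : α → List (ℚ × List GaussRat)}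
    {i j : α → ℕ} (hL : Primrec L) (hi : Primrec i) (hj : Primrec j) :
    Primrec fun a => gramEntry (L a) (i a) (j a) :=
  primrec_gramEntry.comp (Primrec.pair hL (Primrec.pair hi hj))

/-- The squared norm of a list of Gaussian rationals. -/
def listNormSq (v : List GaussRat) : ℚ := (v.map fun z => z.1 * z.1 + z.2 * z.2).sum

theorem primrec_listNormSq : Primrec listNormSq := by
  have hterm : Primrec fun z : GaussRat => z.1 * z.1 + z.2 * z.2 :=
    primrec_rat_add.comp (primrec_rat_mul.comp Primrec.fst Primrec.fst)
      (primrec_rat_mul.comp Primrec.snd Primrec.snd)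
  exact Primrec.list_foldr (f := fun v : List GaussRat => v.map fun z => z.1 * z.1 + z.2 * z.2)
    (Primrec.list_map Primrec.id (hterm.comp Primrec.snd).to₂) (Primrec.const 0)
    (primrec_rat_add.comp (Primrec.fst.comp Primrec.snd) (Primrec.snd.comp Primrec.snd)).to₂

/-- Codewords are given by their length and their value as a binary number. -/
abbrev Codeword := ℕ × ℕ

/-- `k` is a prefix of `k'`. -/
def Codeword.Le (k k' : Codeword) : Prop := k.1 ≤ k'.1 ∧ k'.2 / 2 ^ (k'.1 - k.1) = k.2

theorem primrec_nat_pow : Primrec₂ (fun m n : ℕ => m ^ n) :=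
  Primrec₂.unpaired'.1 Nat.Primrec.pow

theorem primrecRel_codewordLe : PrimrecRel Codeword.Le := by
  have h11 := (Primrec.fst (α := ℕ) (β := ℕ)).comp (Primrec.fst (α := Codeword) (β := Codeword))
  have h12 := (Primrec.snd (α := ℕ) (β := ℕ)).comp (Primrec.fst (α := Codeword) (β := Codeword))
  have h21 := (Primrec.fst (α := ℕ) (β := ℕ)).comp (Primrec.snd (α := Codeword) (β := Codeword))
  have h22 := (Primrec.snd (α := ℕ) (β := ℕ)).comp (Primrec.snd (α := Codeword) (β := Codeword))
  exact (Primrec.nat_le.comp h11 h21).and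
    (Primrec.eq.comp (Primrec.nat_div.comp h22
      (primrec_nat_pow.comp (Primrec.const 2) (Primrec.nat_sub.comp h21 h11))) h12)

/-- A table of vectors, each with a codeword. -/
abbrev CodeTable := List (Codeword × List GaussRat)

/-- A table of vectors with codewords, together with a weighted list of vectors. -/
abbrev Certificate := CodeTable × List (ℚ × List GaussRat)

/-- The weighted vectors of a table. -/
def CodeTable.weighted (T : CodeTable) : List (ℚ × List GaussRat) :=
  -- 40 = 10 · 4: the mixture has total weight at most 10, and a normalized weight w gets a codeword
  -- of length ℓ with w ≤ 4 · 2^(-ℓ).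
  T.map fun e => (40 * (1 / 2) ^ e.1.1, e.2)

/-- The vectors of the table are distinct and the codewords prefix-free. -/
def CodeTable.Separated (T : CodeTable) : Prop :=
  ∀ i < T.length, ∀ j < T.length, i = j ∨
    ((T.getD i default).2 ≠ (T.getD j default).2 ∧
      ¬ (T.getD i default).1.Le (T.getD j default).1)

/-- The certificate shows that the matrix with rows `R` is dominated by the sum of the weighted
projections of its table. -/
def Certifies (R : List (List GaussRat)) (C : Certificate) : Prop :=
  (∀ e ∈ C.1, e.1.2 < 2 ^ e.1.1 ∧ e.2.length = R.length ∧ listNormSq e.2 = 1) ∧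
  C.1.Separated ∧
  -- Domination is witnessed by an exact identity: the excess over `R` is displayed as a nonnegative
  -- combination of rank-one matrices.
  (∀ u ∈ C.2, 0 ≤ u.1) ∧
  ∀ i < R.length, ∀ j < R.length,
    (R.getD i []).getD j 0 + gramEntry C.2 i j = gramEntry C.1.weighted i j

theorem primrecPred_separated : PrimrecPred CodeTable.Separated := by
  have hget : Primrec₂ fun (T : CodeTable) (i : ℕ) => T.getD i default := Primrec.list_getD _
  have hrel : PrimrecPred fun p : ℕ × ℕ × CodeTable => p.1 = p.2.1 ∨
      ((p.2.2.getD p.2.1 default).2 ≠ (p.2.2.getD p.1 default).2 ∧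
        ¬ (p.2.2.getD p.2.1 default).1.Le (p.2.2.getD p.1 default).1) := by
    have hi := hget.comp (Primrec.snd.comp (Primrec.snd (α := ℕ) (β := ℕ × CodeTable)))
      (Primrec.fst.comp Primrec.snd)
    have hj := hget.comp (Primrec.snd.comp (Primrec.snd (α := ℕ) (β := ℕ × CodeTable)))
      Primrec.fst
    exact (Primrec.eq.comp Primrec.fst (Primrec.fst.comp Primrec.snd)).or
      ((Primrec.eq.comp (Primrec.snd.comp hi) (Primrec.snd.comp hj)).not.and
        (primrecRel_codewordLe.comp (Primrec.fst.comp hi) (Primrec.fst.comp hj)).not)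
  have h1 : PrimrecRel fun (n : ℕ) (p : ℕ × CodeTable) => ∀ j < n, j = p.1 ∨
      ((p.2.getD p.1 default).2 ≠ (p.2.getD j default).2 ∧
        ¬ (p.2.getD p.1 default).1.Le (p.2.getD j default).1) :=
    PrimrecRel.forall_lt_nat (R := fun (j : ℕ) (p : ℕ × CodeTable) => j = p.1 ∨
      ((p.2.getD p.1 default).2 ≠ (p.2.getD j default).2 ∧
        ¬ (p.2.getD p.1 default).1.Le (p.2.getD j default).1)) hrel
  have h2 : PrimrecRel fun (n : ℕ) (T : CodeTable) => ∀ i < n, ∀ j < T.length, j = i ∨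
      ((T.getD i default).2 ≠ (T.getD j default).2 ∧
        ¬ (T.getD i default).1.Le (T.getD j default).1) :=
    PrimrecRel.forall_lt_nat (R := fun (i : ℕ) (T : CodeTable) => ∀ j < T.length, j = i ∨
      ((T.getD i default).2 ≠ (T.getD j default).2 ∧
        ¬ (T.getD i default).1.Le (T.getD j default).1))
      (h1.comp (Primrec.list_length.comp Primrec.snd) Primrec.id)
  exact (h2.comp Primrec.list_length Primrec.id).of_eq fun T => by
    simp only [CodeTable.Separated, id, eq_comm]

theorem primrec_weighted : Primrec CodeTable.weighted :=
  Primrec.list_map Primrec.id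
    (Primrec.pair (primrec_rat_mul.comp (Primrec.const 40)
      (primrec_two_inv_pow.comp (Primrec.fst.comp (Primrec.fst.comp Primrec.snd))))
      (Primrec.snd.comp Primrec.snd)).to₂

/-- Only bounded quantifiers over list entries and rational arithmetic occur. This is what allows a
machine to search for certificates. -/
theorem primrecRel_certifies : PrimrecRel Certifies := by
  have hR : Primrec fun p : List (List GaussRat) × Certificate => p.1 := Primrec.fst
  have hT : Primrec fun p : List (List GaussRat) × Certificate => p.2.1 :=
    Primrec.fst.comp Primrec.snd
  have hU : Primrec fun p : List (List GaussRat) × Certificate => p.2.2 :=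
    Primrec.snd.comp Primrec.snd
  have hlen := Primrec.list_length.comp hR
  refine PrimrecPred.and ?_ (PrimrecPred.and (primrecPred_separated.comp hT)
    (PrimrecPred.and ?_ ?_))
  · have : PrimrecRel fun (e : Codeword × List GaussRat) (n : ℕ) =>
        e.1.2 < 2 ^ e.1.1 ∧ e.2.length = n ∧ listNormSq e.2 = 1 :=
      (Primrec.nat_lt.comp (Primrec.snd.comp (Primrec.fst.comp Primrec.fst))
        (primrec_nat_pow.comp (Primrec.const 2)
          (Primrec.fst.comp (Primrec.fst.comp Primrec.fst)))).and <|
      (Primrec.eq.comp (Primrec.list_length.comp (Primrec.snd.comp Primrec.fst)) Primrec.snd).and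
        (Primrec.eq.comp (primrec_listNormSq.comp (Primrec.snd.comp Primrec.fst))
          (Primrec.const 1))
    exact this.forall_mem_list.comp hT hlen
  · exact (primrecPred_rat_nonneg.comp
      (Primrec.fst (α := ℚ) (β := List GaussRat))).forall_mem_list.comp hU
  · have hrel : PrimrecRel fun (j : ℕ) (p : ℕ × List (List GaussRat) × Certificate) =>
        (p.2.1.getD p.1 []).getD j 0 + gramEntry p.2.2.2 p.1 j = gramEntry p.2.2.1.weighted p.1 j := by
      have hi : Primrec fun q : ℕ × ℕ × List (List GaussRat) × Certificate => q.2.1 :=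
        Primrec.fst.comp Primrec.snd
      have hj : Primrec fun q : ℕ × ℕ × List (List GaussRat) × Certificate => q.1 := Primrec.fst
      have hp : Primrec fun q : ℕ × ℕ × List (List GaussRat) × Certificate => q.2.2 :=
        Primrec.snd.comp Primrec.snd
      have hRij : Primrec fun q : ℕ × ℕ × List (List GaussRat) × Certificate =>
          (q.2.2.1.getD q.2.1 []).getD q.1 0 :=
        (Primrec.list_getD (0 : GaussRat)).comp
          ((Primrec.list_getD ([] : List GaussRat)).comp (hR.comp hp) hi) hj
      have hg1 : Primrec fun q : ℕ × ℕ × List (List GaussRat) × Certificate =>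
          gramEntry q.2.2.2.2 q.2.1 q.1 :=
        Primrec.gramEntry (L := fun q => q.2.2.2.2) (hU.comp hp) hi hj
      have hg2 : Primrec fun q : ℕ × ℕ × List (List GaussRat) × Certificate =>
          gramEntry q.2.2.2.1.weighted q.2.1 q.1 :=
        Primrec.gramEntry (L := fun q => q.2.2.2.1.weighted) (primrec_weighted.comp (hT.comp hp)) hi hj
      have hsum : Primrec fun q : ℕ × ℕ × List (List GaussRat) × Certificate =>
          (q.2.2.1.getD q.2.1 []).getD q.1 0 + gramEntry q.2.2.2.2 q.2.1 q.1 :=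
        primrec_gauss_add.comp hRij hg1
      exact Primrec.eq.comp hsum hg2
    have h1 := hrel.forall_lt_nat
    have h2 : PrimrecRel fun (i : ℕ) (p : List (List GaussRat) × Certificate) =>
        ∀ j < p.1.length,
          (p.1.getD i []).getD j 0 + gramEntry p.2.2 i j = gramEntry p.2.1.weighted i j :=
      h1.comp (hlen.comp Primrec.snd) Primrec.id
    exact h2.forall_lt_nat.comp hlen Primrec.id

end Certificates

end

noncomputable section

/-! ### A machine that turns a program for a matrix into programs for pure states -/

section Machine

open Encodable

attribute [instance] PrefixMachine.primcodable

theorem primrec_natStr : Primrec natStr :=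
  (Primrec.list_append.comp
    (Primrec.list_map Primrec.list_range (Primrec.const true).to₂) (Primrec.const [false])).of_eq
    fun k => by simp [natStr, List.map_const']

/-- The theorem encodes entries one by one as numbers, while the machine works with typed lists. The
two codes agree, so the machine can decode what `U` prints. -/
theorem encode_map_gaussCode (v : List GaussRat) :
    encode (v.map gaussCode) = (Primcodable.list (α := GaussRat)).encode v := by
  induction v with
  | nil => rfl
  | cons z v ih =>
    rw [List.map_cons, Encodable.encode_list_cons, ih]
    rfl

theorem encode_map_map_gaussCode (R : List (List GaussRat)) :
    encode (R.map fun v => v.map gaussCode) =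
      (Primcodable.list (α := List GaussRat)).encode R := by
  induction R with
  | nil => rfl
  | cons v R ih =>
    rw [List.map_cons, Encodable.encode_list_cons, ih, encode_map_gaussCode]
    rfl

/-- The string that encodes a list of Gaussian rationals. -/
def listStr (v : List GaussRat) : List Bool := natStr (encode (v.map gaussCode))

theorem vecStr_eq_listStr {d : ℕ} (v : Fin d → GaussRat) : vecStr v = listStr (List.ofFn v) := by
  simp [vecStr, listStr, List.map_ofFn, Function.comp_def]

/-- The list of rows of a matrix. -/
def matRows {d : ℕ} (A : Matrix (Fin d) (Fin d) GaussRat) : List (List GaussRat) :=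
  List.ofFn fun i => List.ofFn fun j => A i j

theorem matStr_eq {d : ℕ} (A : Matrix (Fin d) (Fin d) GaussRat) :
    matStr A = natStr ((Primcodable.list (α := List GaussRat)).encode (matRows A)) := by
  rw [← encode_map_map_gaussCode]
  simp [matStr, matRows, List.map_ofFn, Function.comp_def]

theorem primrec_listStr : Primrec listStr :=
  (primrec_natStr.comp (Primrec.encode (α := List GaussRat))).of_eq fun v => by
    rw [listStr, encode_map_gaussCode]

/-- The codeword obtained by appending a bit. -/
def Codeword.snoc (k : Codeword) (b : Bool) : Codeword := (k.1 + 1, 2 * k.2 + b.toNat)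

theorem primrec_codeword_snoc : Primrec₂ Codeword.snoc :=
  Primrec.pair (Primrec.succ.comp (Primrec.fst.comp Primrec.fst))
    (Primrec.nat_add.comp (Primrec.nat_double.comp (Primrec.snd.comp Primrec.fst))
      ((Primrec.dom_bool Bool.toNat).comp Primrec.snd))

theorem foldl_snoc_fst (u : List Bool) (k : Codeword) :
    (u.foldl Codeword.snoc k).1 = k.1 + u.length := by
  induction u generalizing k with
  | nil => rfl
  | cons b u ih => rw [List.foldl_cons, ih, List.length_cons, Codeword.snoc]; ring

theorem foldl_snoc_snd (u : List Bool) (k : Codeword) :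
    (u.foldl Codeword.snoc k).2 / 2 ^ u.length = k.2 := by
  induction u generalizing k with
  | nil => simp
  | cons b u ih =>
    rw [List.foldl_cons, List.length_cons, pow_succ, ← Nat.div_div_eq_div_mul, ih, Codeword.snoc]
    cases b <;> (simp; try omega)

theorem le_foldl_snoc (u : List Bool) (k : Codeword) : k.Le (u.foldl Codeword.snoc k) := by
  refine ⟨by rw [foldl_snoc_fst]; omega, ?_⟩
  rw [foldl_snoc_fst, Nat.add_sub_cancel_left, foldl_snoc_snd]

theorem exists_foldl_snoc (l a : ℕ) (h : a < 2 ^ l) :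
    ∃ u : List Bool, u.length = l ∧ u.foldl Codeword.snoc (0, 0) = (l, a) := by
  induction l generalizing a with
  | zero => exact ⟨[], rfl, by simp at h; simp [h]⟩
  | succ l ih =>
    obtain ⟨u, hu, hfold⟩ := ih (a / 2) (by rw [pow_succ] at h; omega)
    refine ⟨u ++ [decide (a % 2 = 1)], by simp [hu], ?_⟩
    rw [List.foldl_append, hfold]
    simp only [List.foldl_cons, List.foldl_nil, Codeword.snoc, Prod.mk.injEq, true_and]
    rcases Nat.mod_two_eq_zero_or_one a with h0 | h0 <;> simp [h0] <;> omega

/-- The matrix, as a list of rows, with a given number. -/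
def rowsOfCode (N : ℕ) : Option (List (List GaussRat)) :=
  (Primcodable.list (α := List GaussRat)).decode N

theorem rowsOfCode_encode (R : List (List GaussRat)) :
    rowsOfCode ((Primcodable.list (α := List GaussRat)).encode R) = some R :=
  (Primcodable.list (α := List GaussRat)).encodek R

open Classical in
/-- The table of the `k`-th certificate, if that certifies the matrix with number `N`. -/
def searchTable (N k : ℕ) : Option CodeTable :=
  (rowsOfCode N).bind fun R =>
    (@decode Certificate Primcodable.toEncodable k).bind fun C => if Certifies R C then some C.1 else none

open Classical in
theorem primrec_search {α β γ : Type*} [Primcodable α] [Primcodable β] [Primcodable γ]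
    {R : α → β → Prop} (hR : PrimrecRel R) {f : β → γ} (hf : Primrec f) :
    Primrec₂ fun N k : ℕ => (@decode α Primcodable.toEncodable N).bind fun a =>
      (@decode β Primcodable.toEncodable k).bind fun b => if R a b then some (f b) else none := by
  have h : Primrec₂ fun (a : α) (b : β) => if R a b then some (f b) else none :=
    Primrec.ite hR (Primrec.option_some.comp (hf.comp Primrec.snd)) (Primrec.const none)
  exact Primrec.option_bind (Primrec.decode.comp Primrec.fst)
    (Primrec.option_bind (Primrec.decode.comp (Primrec.snd.comp Primrec.fst))
      (h.comp (Primrec.snd.comp Primrec.fst) Primrec.snd).to₂).to₂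

theorem primrec_searchTable : Primrec₂ searchTable :=
  primrec_search (f := fun C : Certificate => C.1) primrecRel_certifies Primrec.fst

theorem searchTable_eq_some {N k : ℕ} {T : CodeTable} (h : searchTable N k = some T) :
    ∃ R C, rowsOfCode N = some R ∧ Certifies R C ∧ C.1 = T := by
  classical
  rw [searchTable, Option.bind_eq_some_iff] at h
  obtain ⟨R, hR, h⟩ := h
  rw [Option.bind_eq_some_iff] at h
  obtain ⟨C, -, h⟩ := h
  split_ifs at h with hC
  exact ⟨R, C, hR, hC, Option.some.inj h⟩

theorem exists_searchTable {N : ℕ} {R : List (List GaussRat)} {C : Certificate}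
    (hR : rowsOfCode N = some R) (hC : Certifies R C) :
    ∃ k, searchTable N k = some C.1 := by
  refine ⟨@encode Certificate Primcodable.toEncodable C, ?_⟩
  rw [searchTable, hR, Option.bind_some, @encodek Certificate Primcodable.toEncodable C,
    Option.bind_some, if_pos hC]

theorem CodeTable.Separated.eq_of_le {T : CodeTable} (hT : T.Separated)
    {e f : Codeword × List GaussRat} (he : e ∈ T) (hf : f ∈ T) (h : e.1.Le f.1) : e = f := by
  obtain ⟨i, hi, rfl⟩ := List.getElem_of_mem he
  obtain ⟨j, hj, rfl⟩ := List.getElem_of_mem hf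
  rcases hT i hi j hj with rfl | ⟨-, h'⟩
  · rfl
  · rw [List.getD_eq_getElem _ _ hi, List.getD_eq_getElem _ _ hj] at h'
    exact absurd h h'

theorem Codeword.Le.refl (k : Codeword) : k.Le k := ⟨le_rfl, by simp⟩

theorem mem_of_lookup_eq_some {T : CodeTable} {k : Codeword} {v : List GaussRat}
    (h : T.lookup k = some v) : (k, v) ∈ T := by
  induction T with
  | nil => simp at h
  | cons e T ih =>
    obtain ⟨k', v'⟩ := e
    rw [List.lookup_cons] at h
    split at h
    · rename_i hk
      rw [beq_iff_eq] at hk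
      simp_all
    · exact List.mem_cons_of_mem _ (ih h)

theorem CodeTable.Separated.lookup_eq {T : CodeTable} (hT : T.Separated) {k : Codeword}
    {v : List GaussRat} (h : (k, v) ∈ T) : T.lookup k = some v := by
  cases h' : T.lookup k with
  | none =>
    rw [List.lookup_eq_none_iff] at h'
    simpa using h' _ h
  | some v' =>
    have := hT.eq_of_le (mem_of_lookup_eq_some h') h (Codeword.Le.refl k)
    simp_all

/-- A proper prefix of a codeword is not a codeword. The machine therefore goes on reading until the
codeword is complete. -/
theorem CodeTable.Separated.lookup_eq_none {T : CodeTable} (hT : T.Separated)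
    {k : Codeword} {u : List Bool} {v : List GaussRat} (hu : u ≠ [])
    (h : (u.foldl Codeword.snoc k, v) ∈ T) : T.lookup k = none := by
  cases h' : T.lookup k with
  | none => rfl
  | some v' =>
    have := hT.eq_of_le (mem_of_lookup_eq_some h') h (le_foldl_snoc u k)
    have h2 := congrArg (fun e => e.1.1) this
    simp only [foldl_snoc_fst] at h2
    exact absurd (List.length_eq_zero_iff.1 (by omega)) hu

/-! ### The decomposing machine and its runs -/

namespace PrefixMachine

/-- The configurations of the decomposing machine: it simulates `U`, remembering the output; then
it searches a certificate for the matrix with a given number; then it reads a codeword; then it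
halts. -/
abbrev SplitCfg (U : PrefixMachine) : Type :=
  (U.Cfg × List Bool) ⊕ (ℕ × ℕ) ⊕ (CodeTable × Codeword) ⊕ Unit

theorem primrec_lookup :
    Primrec fun s : CodeTable × Codeword => s.1.lookup s.2 :=
  (Primrec.listLookup.comp Primrec.snd Primrec.fst).of_eq fun s => by
    -- The two lookups differ only in the equality test that they use.
    congr 1
    exact lawful_beq_subsingleton _ _

theorem computable_stageCases {U : PrefixMachine} {α σ : Type} [Primcodable α] [Primcodable σ]
    {f : α → U.SplitCfg} {g₁ : α → U.Cfg × List Bool → σ} {g₂ : α → ℕ × ℕ → σ}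
    {g₃ : α → CodeTable × Codeword → σ} {g₄ : α → Unit → σ} (hf : Computable f)
    (h₁ : Computable₂ g₁) (h₂ : Computable₂ g₂) (h₃ : Computable₂ g₃) (h₄ : Computable₂ g₄) :
    Computable fun a => (Sum.elim (g₁ a) (Sum.elim (g₂ a) (Sum.elim (g₃ a) (g₄ a))) (f a) : σ) := by
  have h34 : Computable₂ fun (a : α) (s : (CodeTable × Codeword) ⊕ Unit) =>
      (Sum.elim (g₃ a) (g₄ a) s : σ) :=
    (Computable.sumCasesOn (f := fun p : α × ((CodeTable × Codeword) ⊕ Unit) => p.2)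
      (g := fun p s => g₃ p.1 s) (h := fun p s => g₄ p.1 s) Computable.snd
      (h₃.comp (Computable.fst.comp Computable.fst) Computable.snd)
      (h₄.comp (Computable.fst.comp Computable.fst) Computable.snd)).of_eq
      fun p => by rcases p.2 with s | s <;> rfl
  have h234 : Computable₂ fun (a : α) (s : (ℕ × ℕ) ⊕ (CodeTable × Codeword) ⊕ Unit) =>
      (Sum.elim (g₂ a) (Sum.elim (g₃ a) (g₄ a)) s : σ) :=
    (Computable.sumCasesOn (f := fun p : α × ((ℕ × ℕ) ⊕ (CodeTable × Codeword) ⊕ Unit) => p.2)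
      (g := fun p s => g₂ p.1 s) (h := fun p s => Sum.elim (g₃ p.1) (g₄ p.1) s) Computable.snd
      (h₂.comp (Computable.fst.comp Computable.fst) Computable.snd)
      (h34.comp (Computable.fst.comp Computable.fst) Computable.snd)).of_eq
      fun p => by rcases p.2 with s | s <;> rfl
  exact (Computable.sumCasesOn (g := fun a s => g₁ a s)
    (h := fun a s => Sum.elim (g₂ a) (Sum.elim (g₃ a) (g₄ a)) s) hf h₁ h234).of_eq
    fun a => by rcases f a with s | s <;> rfl

/-- Next configuration in the simulation stage. -/
def splitNext₁ (U : PrefixMachine) (b : Option Bool) (s : U.Cfg × List Bool) : U.SplitCfg :=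
  -- The output `natStr N` has `N + 1` bits, the last being the terminator, so the length minus one
  -- recovers `N`. The search counter starts at 0.
  bif U.halts s.1 then .inr (.inl (s.2.length - 1, 0))
  else .inl (U.next s.1 b, s.2 ++ U.write s.1)

/-- Next configuration in the search stage. -/
def splitNext₂ (U : PrefixMachine) (s : ℕ × ℕ) : U.SplitCfg :=
  (searchTable s.1 s.2).elim (.inr (.inl (s.1, s.2 + 1)))
    fun T => .inr (.inr (.inl (T, (0, 0))))

/-- Next configuration in the reading stage. -/
def splitNext₃ (U : PrefixMachine) (b : Option Bool) (s : CodeTable × Codeword) : U.SplitCfg :=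
  b.elim (.inr (.inr (.inr ()))) fun b => .inr (.inr (.inl (s.1, s.2.snoc b)))

theorem computable_splitNext₁ (U : PrefixMachine) : Computable₂ U.splitNext₁ := by
  have hc : Computable fun p : Option Bool × U.Cfg × List Bool => p.2.1 :=
    Computable.fst.comp Computable.snd
  have ho : Computable fun p : Option Bool × U.Cfg × List Bool => p.2.2 :=
    Computable.snd.comp Computable.snd
  exact Computable.cond (U.halts_computable.comp hc)
    (Computable.sumInr.comp (Computable.sumInl.comp
      (Computable.pair (Computable.pred.comp (Computable.list_length.comp ho))
        (Computable.const 0))))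
    (Computable.sumInl.comp (Computable.pair (U.next_computable.comp hc Computable.fst)
      (Computable.list_append.comp ho (U.write_computable.comp hc))))

theorem computable_splitNext₂ (U : PrefixMachine) : Computable U.splitNext₂ := by
  have h : Computable fun s : ℕ × ℕ => searchTable s.1 s.2 := primrec_searchTable.to_comp
  refine (Computable.option_casesOn (g := fun (_ : ℕ × ℕ) (T : CodeTable) =>
    (.inr (.inr (.inl (T, (0, 0)))) : U.SplitCfg)) h (f := fun s =>
    (.inr (.inl (s.1, s.2 + 1)) : U.SplitCfg)) ?_ ?_).of_eq fun s => ?_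
  · exact Computable.sumInr.comp (Computable.sumInl.comp
      (Computable.pair Computable.fst (Computable.succ.comp Computable.snd)))
  · exact Computable.sumInr.comp (Computable.sumInr.comp (Computable.sumInl.comp
      (Computable.pair Computable.snd (Computable.const (0, 0)))))
  · rw [splitNext₂]; cases searchTable s.1 s.2 <;> rfl

theorem computable_splitNext₃ (U : PrefixMachine) : Computable₂ U.splitNext₃ := by
  refine (Computable.option_casesOn
    (o := fun p : Option Bool × CodeTable × Codeword => p.1)
    (f := fun _ => (.inr (.inr (.inr ())) : U.SplitCfg))
    (g := fun p b => (.inr (.inr (.inl (p.2.1, p.2.2.snoc b))) : U.SplitCfg))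
    Computable.fst (Computable.const _) ?_).of_eq fun p => ?_
  · exact Computable.sumInr.comp (Computable.sumInr.comp (Computable.sumInl.comp
      (Computable.pair (Computable.fst.comp (Computable.snd.comp Computable.fst))
        (primrec_codeword_snoc.to_comp.comp
          (Computable.snd.comp (Computable.snd.comp Computable.fst)) Computable.snd))))
  · obtain ⟨b, s⟩ := p
    cases b <;> rfl

/-- The machine that simulates `U` to get the encoding of a matrix, searches for a certificate,
and outputs the vector of its table for which it reads the codeword. -/
def split (U : PrefixMachine) : PrefixMachine where
  Cfg := U.SplitCfg
  init y := .inl (U.init y, [])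
  halts := Sum.elim (fun _ => false) (Sum.elim (fun _ => false)
    (Sum.elim (fun _ => false) fun _ => true))
  -- No bit is consumed on leaving the simulation, hence the test for halting. In the reading stage
  -- a bit is requested exactly while the word read so far is not in the table.
  reads := Sum.elim (fun s => !U.halts s.1 && U.reads s.1) (Sum.elim (fun _ => false)
    (Sum.elim (fun s => !(s.1.lookup s.2).isSome) fun _ => false))
  write := Sum.elim (fun _ => []) (Sum.elim (fun _ => [])
    (Sum.elim (fun s => ((s.1.lookup s.2).map listStr).getD []) fun _ => []))
  next s b := Sum.elim (U.splitNext₁ b) (Sum.elim U.splitNext₂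
    (Sum.elim (U.splitNext₃ b) fun _ => .inr (.inr (.inr ())))) s
  init_computable := Computable.sumInl.comp (Computable.pair U.init_computable (Computable.const []))
  halts_computable := computable_stageCases Computable.id (Computable.const _).to₂
    (Computable.const _).to₂ (Computable.const _).to₂ (Computable.const _).to₂
  reads_computable := by
    refine computable_stageCases (g₁ := fun _ s => !U.halts s.1 && U.reads s.1)
      (g₃ := fun _ s => !(s.1.lookup s.2).isSome) Computable.id ?_
      (Computable.const _).to₂ ?_ (Computable.const _).to₂
    · exact Primrec.and.to_comp.comp (Primrec.not.to_comp.comp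
        (U.halts_computable.comp (Computable.fst.comp Computable.snd)))
        (U.reads_computable.comp (Computable.fst.comp Computable.snd))
    · exact (Primrec.not.comp (Primrec.option_isSome.comp
        (primrec_lookup.comp Primrec.snd))).to_comp
  write_computable := by
    refine computable_stageCases (g₃ := fun _ s => ((s.1.lookup s.2).map listStr).getD [])
      Computable.id (Computable.const _).to₂ (Computable.const _).to₂ ?_ (Computable.const _).to₂
    exact (Primrec.option_getD.comp (Primrec.option_map (primrec_lookup.comp Primrec.snd)
      (primrec_listStr.comp Primrec.snd).to₂) (Primrec.const [])).to_comp
  next_computable := by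
    refine computable_stageCases (α := U.SplitCfg × Option Bool)
      (g₁ := fun p s => U.splitNext₁ p.2 s) (g₂ := fun _ s => U.splitNext₂ s)
      (g₃ := fun p s => U.splitNext₃ p.2 s) Computable.fst ?_ ?_ ?_ (Computable.const _).to₂
    · exact U.computable_splitNext₁.comp (Computable.snd.comp Computable.fst) Computable.snd
    · exact U.computable_splitNext₂.comp Computable.snd
    · exact U.computable_splitNext₃.comp (Computable.snd.comp Computable.fst) Computable.snd

theorem split_step_halts {U : PrefixMachine} {c : U.Cfg} (hc : U.halts c = true)
    (o p z : List Bool) :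
    U.split.step (.inl (c, o), p, z) = (.inr (.inl (o.length - 1, 0)), p, z) := by
  simp [step, split, hc, splitNext₁]

theorem split_step_reads {U : PrefixMachine} {c : U.Cfg} (hc : U.halts c = false)
    (hr : U.reads c = true) (o p z : List Bool) (b : Bool) :
    U.split.step (.inl (c, o), b :: p, z) =
      (.inl (U.next c (some b), o ++ U.write c), p, z) := by
  simp [step, split, hc, hr, splitNext₁]

theorem split_step_silent {U : PrefixMachine} {c : U.Cfg} (hc : U.halts c = false)
    (hr : U.reads c = false) (o p z : List Bool) :
    U.split.step (.inl (c, o), p, z) =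
      (.inl (U.next c none, o ++ U.write c), p, z) := by
  simp [step, split, hc, hr, splitNext₁]

/-- `U` halts after using up exactly `p`, so the simulation never touches the continuation `w`,
which is left for the codeword. -/
theorem split_simulates (U : PrefixMachine) (t : ℕ) (c c' : U.Cfg) (p w o o' : List Bool)
    (h : U.step^[t] (c, p, o) = (c', [], o')) (hc' : U.halts c' = true) :
    ∃ t', U.split.step^[t'] (.inl (c, o), p ++ w, []) = (.inl (c', o'), w, []) := by
  induction t generalizing c p o with
  | zero =>
    simp only [Function.iterate_zero, id, Prod.mk.injEq] at h
    obtain ⟨rfl, rfl, rfl⟩ := h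
    exact ⟨0, rfl⟩
  | succ t ih =>
    -- A situation fixed by `step`, such as a halted or starved one, is already the final one. The
    -- remaining cases make a step that the new machine can copy.
    by_cases hs : U.step (c, p, o) = (c, p, o)
    · rw [Function.iterate_fixed hs] at h
      simp only [Prod.mk.injEq] at h
      obtain ⟨rfl, rfl, rfl⟩ := h
      exact ⟨0, rfl⟩
    rw [Function.iterate_succ_apply] at h
    cases hc : U.halts c with
    | true => exact absurd (by simp [step, hc]) hs
    | false =>
      cases hr : U.reads c with
      | false =>
        have : U.step (c, p, o) = (U.next c none, p, o ++ U.write c) := by simp [step, hc, hr]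
        rw [this] at h
        obtain ⟨t', ht'⟩ := ih _ _ _ h
        exact ⟨t' + 1, by rw [Function.iterate_succ_apply, split_step_silent hc hr, ht']⟩
      | true =>
        cases p with
        | nil => exact absurd (by simp [step, hc, hr]) hs
        | cons b p =>
          have : U.step (c, b :: p, o) = (U.next c (some b), p, o ++ U.write c) := by
            simp [step, hc, hr]
          rw [this] at h
          obtain ⟨t', ht'⟩ := ih _ _ _ h
          exact ⟨t' + 1, by
            rw [Function.iterate_succ_apply, List.cons_append, split_step_reads hc hr, ht']⟩

theorem split_searches {U : PrefixMachine} {N k : ℕ} {T : CodeTable}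
    (hk : searchTable N k = some T) (hmin : ∀ j < k, searchTable N j = none) (w : List Bool)
    (i : ℕ) (hi : i ≤ k) :
    U.split.step^[k - i + 1] (.inr (.inl (N, i)), w, []) =
      (.inr (.inr (.inl (T, (0, 0)))), w, []) := by
  obtain ⟨d, rfl⟩ := Nat.exists_eq_add_of_le hi
  rw [Nat.add_sub_cancel_left]
  clear hi
  induction d generalizing i with
  | zero => simp [step, split, splitNext₂, show searchTable N i = some T from hk]
  | succ d ih =>
    have hstep : U.split.step (.inr (.inl (N, i)), w, []) = (.inr (.inl (N, i + 1)), w, []) := by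
      simp [step, split, splitNext₂, hmin i (by omega)]
    rw [Function.iterate_succ_apply, hstep]
    exact ih (i + 1) (by rwa [Nat.add_right_comm] ) fun j hj => hmin j (by omega)

theorem split_decodes {U : PrefixMachine} {T : CodeTable} (hT : T.Separated) (u : List Bool)
    (k : Codeword) (v : List GaussRat) (h : (u.foldl Codeword.snoc k, v) ∈ T) :
    U.split.step^[u.length + 1] (.inr (.inr (.inl (T, k))), u, []) =
      (.inr (.inr (.inr ())), [], listStr v) := by
  induction u generalizing k with
  | nil =>
    have hl := hT.lookup_eq h
    rw [List.foldl_nil] at hl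
    simp [step, split, splitNext₃, hl]
  | cons b u ih =>
    have hl := hT.lookup_eq_none (List.cons_ne_nil b u) h
    have hstep : U.split.step (.inr (.inr (.inl (T, k))), b :: u, []) =
        (.inr (.inr (.inl (T, k.snoc b))), u, []) := by
      simp [step, split, splitNext₃, hl]
    rw [List.length_cons, Function.iterate_succ_apply, hstep]
    exact ih (k.snoc b) h

/-- The search depends on `N` alone, so one and the same first certificate serves all codewords. It
need not be the one assumed to exist, hence the existential conclusion. -/
theorem split_outputs {U : PrefixMachine} {y p : List Bool} {N : ℕ}
    {R : List (List GaussRat)} (hp : U.Outputs y p (natStr N))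
    (hR : rowsOfCode N = some R) (hC : ∃ C, Certifies R C) :
    ∃ C, Certifies R C ∧ ∀ e ∈ C.1, ∃ w : List Bool, w.length = e.1.1 ∧
      U.split.Outputs y (p ++ w) (listStr e.2) := by
  obtain ⟨C₀, hC₀⟩ := hC
  classical
  let hex := exists_searchTable hR hC₀
  have hex' : ∃ k, (searchTable N k).isSome := ⟨hex.choose, by rw [hex.choose_spec]; rfl⟩
  obtain ⟨T, hT⟩ := Option.isSome_iff_exists.1 (Nat.find_spec hex')
  have hmin : ∀ j < Nat.find hex', searchTable N j = none := fun j hj => by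
    simpa using Nat.find_min hex' hj
  obtain ⟨R', C, hR', hC, rfl⟩ := searchTable_eq_some hT
  obtain rfl : R = R' := Option.some.inj (hR.symm.trans hR')
  refine ⟨C, hC, fun e he => ?_⟩
  obtain ⟨w, hw, hfold⟩ := exists_foldl_snoc e.1.1 e.1.2 (hC.1 e he).1
  refine ⟨w, hw, ?_⟩
  obtain ⟨t, h1, h2, h3⟩ := hp
  have hrun : U.step^[t] (U.init y, p, []) = ((U.run y p t).1, [], natStr N) :=
    Prod.ext rfl (Prod.ext h2 h3)
  obtain ⟨t', ht'⟩ := U.split_simulates t _ _ p w [] _ hrun h1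
  have hdec := split_decodes (U := U) hC.2.1 w (0, 0) e.2 (by rw [hfold]; exact he)
  have hsearch := split_searches (U := U) hT hmin w 0 (Nat.zero_le _)
  -- Read from the right, the running time is: simulation, one step to leave it, search, and
  -- decoding with one final step that writes the vector.
  have hfinal : U.split.run y (p ++ w) ((w.length + 1) + ((Nat.find hex' - 0 + 1) + (1 + t'))) =
      (.inr (.inr (.inr ())), [], listStr e.2) := by
    have key : ∀ (a b d : ℕ) (s), U.split.step^[a + (b + (1 + d))] s =
        U.split.step^[a] (U.split.step^[b] (U.split.step (U.split.step^[d] s))) := fun a b d s => by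
      rw [Function.iterate_add_apply, Function.iterate_add_apply, Function.iterate_add_apply,
        Function.iterate_one]
    rw [run, key]
    change U.split.step^[w.length + 1] (U.split.step^[Nat.find hex' - 0 + 1] (U.split.step
      (U.split.step^[t'] (.inl (U.init y, []), p ++ w, [])))) = _
    rw [ht', split_step_halts h1]
    rw [show (natStr N).length - 1 = N by simp [natStr], hsearch, hdec]
  exact ⟨_, by rw [hfinal]; rfl, by rw [hfinal], by rw [hfinal]⟩

/-! ### Complexity bounds obtained from the machine -/

theorem K_le_length {U : PrefixMachine} {y p x : List Bool} (h : U.Outputs y p x) :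
    U.K x y ≤ p.length :=
  iInf_le_of_le ⟨p, h⟩ le_rfl

theorem exists_outputs_of_K_eq {U : PrefixMachine} {x y : List Bool} {k : ℕ}
    (h : U.K x y = k) : ∃ p : List Bool, U.Outputs y p x ∧ p.length = k := by
  have hne : Nonempty {p : List Bool // U.Outputs y p x} := by
    by_contra hne
    rw [not_nonempty_iff] at hne
    rw [K, iInf_of_empty] at h
    exact absurd h (by simp)
  obtain ⟨p, hp⟩ := ENat.exists_eq_iInf
    fun p : {p : List Bool // U.Outputs y p x} => (p.1.length : ℕ∞)
  exact ⟨p.1, p.2, by rw [← K, h] at hp; exact_mod_cast hp⟩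

/-- A shortest program for the matrix followed by a codeword is a program for `split`, and
universality transfers its length to `U`. The constant is independent of the matrix and of `y`. -/
theorem IsUniversal.exists_K_listStr_le {U : PrefixMachine} (hU : U.IsUniversal) :
    ∃ c : ℕ, ∀ (y : List Bool) (N k : ℕ) (R : List (List GaussRat)), U.K (natStr N) y = k →
      rowsOfCode N = some R → (∃ C, Certifies R C) →
      ∃ C, Certifies R C ∧ ∀ e ∈ C.1, U.K (listStr e.2) y ≤ (k + e.1.1 + c : ℕ) := by
  obtain ⟨c, hc⟩ := hU U.split
  refine ⟨c, fun y N k R hk hR hC => ?_⟩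
  obtain ⟨p, hp, hlen⟩ := exists_outputs_of_K_eq hk
  obtain ⟨C, hC, h⟩ := split_outputs hp hR hC
  refine ⟨C, hC, fun e he => ?_⟩
  obtain ⟨w, hw, hout⟩ := h e he
  refine (hc _ _).trans ?_
  have := K_le_length hout
  rw [List.length_append, hlen, hw] at this
  push_cast at this ⊢
  gcongr

/-- The machine that outputs a fixed string without reading its program. -/
def const (x : List Bool) : PrefixMachine where
  Cfg := Bool
  init _ := false
  halts b := b
  reads _ := false
  write _ := x
  next _ _ := true
  init_computable := Computable.const _
  halts_computable := Computable.id
  reads_computable := Computable.const _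
  write_computable := Computable.const _
  next_computable := (Computable.const _).to₂

theorem IsUniversal.K_ne_top {U : PrefixMachine} (hU : U.IsUniversal) (x y : List Bool) :
    U.K x y ≠ ⊤ := by
  obtain ⟨c, hc⟩ := hU (const x)
  have h : (const x).Outputs y [] x := ⟨1, rfl, rfl, rfl⟩
  have := (hc x y).trans (add_le_add_left (K_le_length h) _)
  refine ne_top_of_le_ne_top ?_ this
  simp

end PrefixMachine

end Machine

end

noncomputable section

/-! ### Decomposition of positive semidefinite matrices over subfields -/

section Decomposition

open Matrix

/-- For positive semidefinite `A`, a vanishing ⟨e, A e⟩ forces A e = 0; here e is a basis vector. -/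
theorem Matrix.PosSemidef.apply_eq_zero {d : ℕ} {A : Matrix (Fin d) (Fin d) ℂ}
    (hA : A.PosSemidef) {i : Fin d} (hi : A i i = 0) (j : Fin d) : A i j = 0 ∧ A j i = 0 := by
  have h := (hA.dotProduct_mulVec_zero_iff (Pi.single i 1)).1 (by simp [hi])
  have hj : A j i = 0 := by simpa using congrFun h j
  refine ⟨?_, hj⟩
  rw [← hA.isHermitian.apply, hj, star_zero]

/-- Eliminating row and column `i` is a congruence. The Schur complement is `A * P`, where `P` is
the identity minus a rank-one matrix; its `i`-th row vanishes, so multiplying by `Pᴴ` on the left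
changes nothing and it equals `Pᴴ * A * P`. -/
theorem Matrix.PosSemidef.exists_schur {d : ℕ} {A : Matrix (Fin d) (Fin d) ℂ}
    (hA : A.PosSemidef) (i : Fin d) (hi : A i i ≠ 0) :
    (A - (A i i)⁻¹ • vecMulVec (fun j => A j i) (star fun j => A j i)).PosSemidef := by
  have hherm : ∀ j k, star (A j k) = A k j := fun j k => hA.isHermitian.apply k j
  let P : Matrix (Fin d) (Fin d) ℂ :=
    1 - (A i i)⁻¹ • vecMulVec (Pi.single i 1) (fun k => A i k)
  have hAP : A * P = A - (A i i)⁻¹ • vecMulVec (fun j => A j i) (star fun j => A j i) := by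
    have h1 : (fun k => A i k) = star fun j => A j i := funext fun k => (hherm k i).symm
    simp only [P, mul_sub, mul_one, Matrix.mul_smul, mul_vecMulVec, h1]
    congr 3
    ext j
    simp
  have hrow : (Pi.single i 1 : Fin d → ℂ) ᵥ* (A * P) = 0 := by
    ext k
    rw [hAP]
    simp [vecMulVec_apply, hherm, hi]
  have hPAP : Pᴴ * A * P = A * P := by
    rw [mul_assoc]
    have hP : Pᴴ = 1 - (A i i)⁻¹ • vecMulVec (fun k => A k i) (Pi.single i 1) := by
      have h1 : (star fun k => A i k) = fun k => A k i := funext fun k => hherm i k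
      have h2 : star (Pi.single i 1 : Fin d → ℂ) = Pi.single i 1 := by
        rw [← Pi.single_star, star_one]
      simp only [P, conjTranspose_sub, conjTranspose_one, conjTranspose_smul,
        conjTranspose_vecMulVec, star_inv₀, hherm, h1, h2]
    rw [hP]
    rw [sub_mul, one_mul, smul_mul, vecMulVec_mul, hrow]
    simp
  rw [← hAP, ← hPAP]
  exact hA.conjTranspose_mul_mul_same P

/-- A positive semidefinite matrix with entries in a subfield is a nonnegative combination of
rank-one projections with entries in that subfield. -/
theorem Matrix.PosSemidef.exists_rankOne_decomposition {d : ℕ} (G : Subfield ℂ)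
    {A : Matrix (Fin d) (Fin d) ℂ} (hA : A.PosSemidef) (hG : ∀ i j, A i j ∈ G) :
    ∃ L : List (ℝ × (Fin d → ℂ)),
      (∀ e ∈ L, 0 ≤ e.1 ∧ ((e.1 : ℝ) : ℂ) ∈ G ∧ ∀ i, e.2 i ∈ G) ∧
      A = (L.map fun e => ((e.1 : ℝ) : ℂ) • vecMulVec e.2 (star e.2)).sum := by
  -- Induction on a set `S` containing all nonzero rows. A Schur complement removes one row using
  -- only field operations, so no root or eigenvalue leaves `G`.
  have key : ∀ S : Finset (Fin d), ∀ A : Matrix (Fin d) (Fin d) ℂ, A.PosSemidef →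
      (∀ i j, A i j ∈ G) → (∀ i ∉ S, ∀ j, A i j = 0) →
      ∃ L : List (ℝ × (Fin d → ℂ)),
        (∀ e ∈ L, 0 ≤ e.1 ∧ ((e.1 : ℝ) : ℂ) ∈ G ∧ ∀ i, e.2 i ∈ G) ∧
        A = (L.map fun e => ((e.1 : ℝ) : ℂ) • vecMulVec e.2 (star e.2)).sum := by
    intro S
    induction S using Finset.induction_on with
    | empty =>
      intro A _ _ h
      exact ⟨[], by simp, by ext i j; simp [h i (Finset.notMem_empty i) j]⟩
    | insert i S _ ih =>
      intro A hA hG h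
      by_cases hi : A i i = 0
      · refine ih A hA hG fun j hj k => ?_
        rcases eq_or_ne j i with rfl | hne
        · exact (hA.apply_eq_zero hi k).1
        · exact h j (by simp [hne, hj]) k
      · have hpos : 0 ≤ A i i := hA.diag_nonneg
        have hreal : (((A i i).re : ℝ) : ℂ) = A i i := by
          rw [Complex.nonneg_iff] at hpos
          exact Complex.ext rfl hpos.2
        have hherm : ∀ j k, star (A j k) = A k j := fun j k => hA.isHermitian.apply k j
        obtain ⟨L, hL, hsum⟩ := ih
          (A - (A i i)⁻¹ • vecMulVec (fun j => A j i) (star fun j => A j i))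
          (hA.exists_schur i hi)
          (fun j k => by
            simp only [sub_apply, smul_apply, vecMulVec_apply, Pi.star_apply, hherm, smul_eq_mul]
            exact G.sub_mem (hG j k) (G.mul_mem (G.inv_mem (hG i i))
              (G.mul_mem (hG j i) (hG i k))))
          (fun j hj k => by
            simp only [sub_apply, smul_apply, vecMulVec_apply, Pi.star_apply, hherm, smul_eq_mul]
            rcases eq_or_ne j i with rfl | hne
            · field_simp
              simp
            · have := h j (by simp [hne, hj])
              simp [this])
        refine ⟨((A i i).re⁻¹, fun j => A j i) :: L, ?_, ?_⟩
        · intro e he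
          rcases List.mem_cons.1 he with rfl | he
          · refine ⟨inv_nonneg.2 (Complex.nonneg_iff.1 hpos).1, ?_, fun j => hG j i⟩
            push_cast
            rw [hreal]
            exact G.inv_mem (hG i i)
          · exact hL e he
        · rw [List.map_cons, List.sum_cons, ← hsum]
          push_cast
          rw [hreal]
          abel
  exact key Finset.univ A hA hG fun i hi => absurd (Finset.mem_univ i) hi

/-- The field of Gaussian rationals. -/
def gaussField : Subfield ℂ where
  carrier := Set.range GaussRat.toComplex
  mul_mem' := by
    rintro _ _ ⟨z, rfl⟩ ⟨w, rfl⟩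
    refine ⟨(z.1 * w.1 - z.2 * w.2, z.1 * w.2 + z.2 * w.1), ?_⟩
    apply Complex.ext <;> simp [GaussRat.toComplex]
  one_mem' := ⟨(1, 0), by apply Complex.ext <;> simp [GaussRat.toComplex]⟩
  add_mem' := by
    rintro _ _ ⟨z, rfl⟩ ⟨w, rfl⟩
    exact ⟨z + w, GaussRat.toComplex_add z w⟩
  zero_mem' := ⟨(0, 0), by apply Complex.ext <;> simp [GaussRat.toComplex]⟩
  neg_mem' := by
    rintro _ ⟨z, rfl⟩
    exact ⟨(-z.1, -z.2), by apply Complex.ext <;> simp [GaussRat.toComplex]⟩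
  inv_mem' := by
    rintro _ ⟨z, rfl⟩
    refine ⟨(z.1 / (z.1 ^ 2 + z.2 ^ 2), -z.2 / (z.1 ^ 2 + z.2 ^ 2)), ?_⟩
    apply Complex.ext <;> simp [GaussRat.toComplex, Complex.inv_re, Complex.inv_im,
      Complex.normSq_apply, pow_two]

theorem toComplex_mem_gaussField (z : GaussRat) : z.toComplex ∈ gaussField := ⟨z, rfl⟩

theorem ratCast_mem_gaussField (q : ℚ) : ((q : ℝ) : ℂ) ∈ gaussField :=
  ⟨(q, 0), by apply Complex.ext <;> simp [GaussRat.toComplex]⟩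

theorem exists_rat_of_ofReal_mem_gaussField {x : ℝ} (h : (x : ℂ) ∈ gaussField) :
    ∃ q : ℚ, (q : ℝ) = x := by
  obtain ⟨z, hz⟩ := h
  exact ⟨z.1, congrArg Complex.re hz⟩

theorem exists_gauss_decomposition {d : ℕ} {A : Matrix (Fin d) (Fin d) ℂ} (hA : A.PosSemidef)
    (hG : ∀ i j, A i j ∈ gaussField) :
    ∃ L : List (ℚ × (Fin d → GaussRat)), (∀ e ∈ L, 0 ≤ e.1) ∧
      A = (L.map fun e => ((e.1 : ℝ) : ℂ) •
        vecMulVec (fun i => (e.2 i).toComplex) (star fun i => (e.2 i).toComplex)).sum := by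
  obtain ⟨L, hL, rfl⟩ := hA.exists_rankOne_decomposition gaussField hG
  clear hA hG
  induction L with
  | nil => exact ⟨[], by simp, rfl⟩
  | cons e L ih =>
    obtain ⟨L', hL', heq⟩ := ih fun e he => hL e (List.mem_cons_of_mem _ he)
    obtain ⟨h0, h1, h2⟩ := hL e List.mem_cons_self
    obtain ⟨q, hq⟩ := exists_rat_of_ofReal_mem_gaussField h1
    choose v hv using h2
    refine ⟨(q, v) :: L', ?_, ?_⟩
    · intro f hf
      rcases List.mem_cons.1 hf with rfl | hf
      · rw [← hq] at h0
        exact_mod_cast h0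
      · exact hL' f hf
    · rw [List.map_cons, List.sum_cons, List.map_cons, List.sum_cons, heq]
      simp only [hq, hv]

end Decomposition

end

noncomputable section

/-! ### Mixtures of elementary pure states dominate elementary matrices -/

section Mixtures

open Matrix

/-- The vector of complex numbers given by a vector of Gaussian rationals. -/
def vecC {d : ℕ} (v : Fin d → GaussRat) : Fin d → ℂ := fun i => (v i).toComplex

/-- The rank-one operator `|v⟩⟨v|`. -/
def rankOne {d : ℕ} (v : Fin d → ℂ) : Matrix (Fin d) (Fin d) ℂ := vecMulVec v (star v)

theorem posSemidef_rankOne {d : ℕ} (v : Fin d → ℂ) : (rankOne v).PosSemidef :=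
  posSemidef_vecMulVec_self_star v

theorem ElemPure.proj_eq {n : ℕ} (φ : ElemPure n) : φ.proj = rankOne (vecC φ.1) := rfl

theorem posSemidef_proj {n : ℕ} (φ : ElemPure n) : φ.proj.PosSemidef := posSemidef_rankOne _

/-- Parallelogram identity: the difference is the rank-one operator of `a + b`. -/
theorem posSemidef_rankOne_sub {d : ℕ} (a b : Fin d → ℂ) :
    ((2 : ℂ) • rankOne a + (2 : ℂ) • rankOne b - rankOne (a - b)).PosSemidef := by
  have : (2 : ℂ) • rankOne a + (2 : ℂ) • rankOne b - rankOne (a - b) = rankOne (a + b) := by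
    ext i j
    simp only [rankOne, Matrix.sub_apply, Matrix.add_apply, Matrix.smul_apply, vecMulVec_apply, Pi.star_apply,
      Pi.add_apply, Pi.sub_apply, star_add, star_sub, smul_eq_mul]
    ring
  rw [this]
  exact posSemidef_rankOne _

theorem rankOne_smul {d : ℕ} (y : ℚ) (v : Fin d → ℂ) :
    rankOne (((y : ℝ) : ℂ) • v) = (((y ^ 2 : ℚ) : ℝ) : ℂ) • rankOne v := by
  ext i j
  simp only [rankOne, vecMulVec_apply, Matrix.smul_apply, Pi.smul_apply, Pi.star_apply, star_mul',
    smul_eq_mul, RCLike.star_def, Complex.conj_ofReal]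
  push_cast
  ring

theorem Matrix.PosSemidef.rat_smul {d : ℕ} {A : Matrix (Fin d) (Fin d) ℂ} (hA : A.PosSemidef)
    {c : ℚ} (hc : 0 ≤ c) : (c • A).PosSemidef := by
  have : c • A = ((c : ℝ) : ℂ) • A := by
    ext i j
    simp [Rat.smul_def]
  rw [this]
  exact hA.smul (by exact_mod_cast hc)

/-- The squared norm of a vector of Gaussian rationals. -/
def normSqQ {d : ℕ} (v : Fin d → GaussRat) : ℚ := ∑ i, ((v i).1 ^ 2 + (v i).2 ^ 2)

/-- The mixture of elementary pure states with given weights. -/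
def mixture {n : ℕ} : (ElemPure n →₀ ℚ) →ₗ[ℚ] Matrix (Fin (2 ^ n)) (Fin (2 ^ n)) ℂ :=
  Finsupp.linearCombination ℚ ElemPure.proj

/-- The total weight. -/
def totalWeight {n : ℕ} : (ElemPure n →₀ ℚ) →ₗ[ℚ] ℚ :=
  Finsupp.linearCombination ℚ fun _ => (1 : ℚ)

theorem exists_rat_sq_between {s : ℚ} (hs : 0 < s) : ∃ k : ℚ, 0 < k ∧ s / 4 ≤ k ^ 2 ∧ k ^ 2 ≤ s := by
  have hs' : (0 : ℝ) < s := by exact_mod_cast hs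
  have hsq : 0 < Real.sqrt s := Real.sqrt_pos.2 hs'
  obtain ⟨k, h1, h2⟩ := exists_rat_btwn (show Real.sqrt s / 2 < Real.sqrt s by linarith)
  have hk : (0 : ℝ) < k := by linarith
  have hss := Real.sq_sqrt hs'.le
  have h3 : (s : ℝ) / 4 ≤ (k : ℝ) ^ 2 := by nlinarith
  have h4 : (k : ℝ) ^ 2 ≤ s := by nlinarith
  exact ⟨k, by exact_mod_cast hk, by exact_mod_cast h3, by exact_mod_cast h4⟩

/-- A real multiple of the first basis vector. -/
def firstCoord (n : ℕ) (l : ℚ) : Fin (2 ^ n) → GaussRat := fun i => if i = 0 then (l, 0) else 0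

/-- The first basis vector. -/
def basisZero (n : ℕ) : ElemPure n :=
  ⟨firstCoord n 1, by
    rw [Finset.sum_eq_single 0]
    · simp [firstCoord]
    · intro i _ hi; simp [firstCoord, hi]
    · simp⟩

theorem sum_weight_basisZero {n : ℕ} (v : Fin (2 ^ n) → GaussRat) (l : ℚ) :
    normSqQ (v + firstCoord n l) =
      ((v 0).1 + l) ^ 2 + (normSqQ v - (v 0).1 ^ 2) := by
  rw [normSqQ, normSqQ, ← Finset.add_sum_erase _ _ (Finset.mem_univ 0),
    ← Finset.add_sum_erase _ (fun i => (v i).1 ^ 2 + (v i).2 ^ 2) (Finset.mem_univ 0)]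
  have : ∑ x ∈ Finset.univ.erase (0 : Fin (2 ^ n)),
      (((v + firstCoord n l) x).1 ^ 2 + ((v + firstCoord n l) x).2 ^ 2) =
      ∑ x ∈ Finset.univ.erase (0 : Fin (2 ^ n)), ((v x).1 ^ 2 + (v x).2 ^ 2) := by
    refine Finset.sum_congr rfl fun i hi => ?_
    rw [Pi.add_apply, firstCoord, if_neg (Finset.ne_of_mem_erase hi), add_zero]
  rw [this]
  simp [firstCoord]
  ring

theorem sq_le_normSqQ {d : ℕ} (v : Fin d → GaussRat) (i : Fin d) : (v i).1 ^ 2 ≤ normSqQ v := by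
  have h := Finset.single_le_sum (f := fun i => (v i).1 ^ 2 + (v i).2 ^ 2)
    (fun i _ => by positivity) (Finset.mem_univ i)
  have h2 : 0 ≤ (v i).2 ^ 2 := by positivity
  rw [normSqQ]
  linarith

theorem eq_zero_of_normSqQ {d : ℕ} {v : Fin d → GaussRat} (h : normSqQ v = 0) : v = 0 := by
  ext i
  · have := sq_le_normSqQ v i
    rw [h] at this
    simpa using pow_eq_zero_iff (two_ne_zero) |>.1 (le_antisymm this (by positivity))
  · rw [normSqQ, Finset.sum_eq_zero_iff_of_nonneg fun i _ => by positivity] at h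
    have := h i (Finset.mem_univ i)
    have h1 : 0 ≤ (v i).1 ^ 2 := by positivity
    have h2 : 0 ≤ (v i).2 ^ 2 := by positivity
    simpa using pow_eq_zero_iff (two_ne_zero) |>.1 (show (v i).2 ^ 2 = 0 by linarith)

/-- Some translate of `v` along the first basis vector has a norm that is rational, and comparable
to that of `v`. -/
theorem exists_rational_norm {n : ℕ} (v : Fin (2 ^ n) → GaussRat) :
    ∃ l y : ℚ, normSqQ (v + firstCoord n l) = y ^ 2 ∧
      2 * y ^ 2 + 2 * l ^ 2 ≤ 10 * normSqQ v := by
  set r := (v 0).1 with hr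
  set s := normSqQ v - r ^ 2 with hs
  have hs0 : 0 ≤ s := sub_nonneg.2 (sq_le_normSqQ v 0)
  rcases hs0.eq_or_lt with h0 | hpos
  · refine ⟨-r, 0, ?_, ?_⟩
    · rw [sum_weight_basisZero, ← hr, ← hs, ← h0]; ring
    · have : normSqQ v = r ^ 2 := by linarith
      rw [this]; nlinarith [sq_nonneg r]
  · obtain ⟨k, hk, h1, h2⟩ := exists_rat_sq_between hpos
    have hx : ((s / k - k) / 2) ^ 2 ≤ 3 / 4 * s := by
      have h3 : (s / k) ^ 2 ≤ 4 * s := by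
        rw [div_pow, div_le_iff₀ (by positivity)]
        nlinarith
      have h4 : s / k * k = s := div_mul_cancel₀ _ hk.ne'
      nlinarith
    have hy : ((s / k + k) / 2) ^ 2 = ((s / k - k) / 2) ^ 2 + s := by
      field_simp
      ring
    refine ⟨(s / k - k) / 2 - r, (s / k + k) / 2, ?_, ?_⟩
    · rw [sum_weight_basisZero, ← hr, ← hs, hy]; ring
    · have : normSqQ v = s + r ^ 2 := by rw [hs]; ring
      rw [this, hy]
      nlinarith [sq_nonneg ((s / k - k) / 2 + r), sq_nonneg r]

theorem vecC_add_single {n : ℕ} (v : Fin (2 ^ n) → GaussRat) (l : ℚ) :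
    vecC v = vecC (v + firstCoord n l) - ((l : ℝ) : ℂ) • vecC (basisZero n).1 := by
  ext i
  rcases eq_or_ne i 0 with rfl | hi
  · apply Complex.ext <;> simp [vecC, basisZero, GaussRat.toComplex, firstCoord]
  · apply Complex.ext <;> simp [vecC, basisZero, GaussRat.toComplex, firstCoord, hi]

theorem exists_mixture_rankOne {n : ℕ} (v : Fin (2 ^ n) → GaussRat) :
    ∃ W : ElemPure n →₀ ℚ, (∀ φ, 0 ≤ W φ) ∧ totalWeight W ≤ 10 * normSqQ v ∧
      (mixture W - rankOne (vecC v)).PosSemidef := by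
  obtain ⟨l, y, hnorm, hle⟩ := exists_rational_norm v
  obtain ⟨φ, hφ⟩ : ∃ φ : ElemPure n,
      vecC (v + firstCoord n l) = ((y : ℝ) : ℂ) • vecC φ.1 := by
    -- If y = 0 the shifted vector is zero and any state serves. Otherwise division by the rational
    -- norm y gives an elementary unit vector.
    by_cases hy : y = 0
    · refine ⟨basisZero n, ?_⟩
      rw [eq_zero_of_normSqQ (hnorm.trans (by simp [hy]))]
      ext i
      apply Complex.ext <;> simp [vecC, hy, GaussRat.toComplex]
    · refine ⟨⟨fun i => GaussRat.scale y⁻¹ ((v + firstCoord n l) i), ?_⟩, ?_⟩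
      · have : ∀ i, (GaussRat.scale y⁻¹ ((v + firstCoord n l) i)).1 ^ 2 +
            (GaussRat.scale y⁻¹ ((v + firstCoord n l) i)).2 ^ 2 =
            (y ^ 2)⁻¹ * (((v + firstCoord n l) i).1 ^ 2 +
              ((v + firstCoord n l) i).2 ^ 2) := fun i => by
          simp only [GaussRat.scale]; field_simp
        simp only [this]
        rw [← Finset.mul_sum]
        change (y ^ 2)⁻¹ * normSqQ _ = 1
        rw [hnorm]
        field_simp
      · ext i
        have hy' : (y : ℂ) ≠ 0 := by exact_mod_cast hy
        simp only [vecC, GaussRat.toComplex_scale, Pi.smul_apply, smul_eq_mul]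
        simp [hy']
  -- Since v = yφ - l e₀, `posSemidef_rankOne_sub` gives these two weights. The two states may
  -- coincide, so the weights are added.
  refine ⟨Finsupp.single φ (2 * y ^ 2) + Finsupp.single (basisZero n) (2 * l ^ 2), ?_, ?_, ?_⟩
  · classical
    intro ψ
    rw [Finsupp.add_apply]
    refine add_nonneg ?_ ?_ <;>
    · rw [Finsupp.single_apply]
      split_ifs <;> positivity
  · simp only [totalWeight, map_add, Finsupp.linearCombination_single, smul_eq_mul, mul_one]
    exact hle
  · have h := posSemidef_rankOne_sub (((y : ℝ) : ℂ) • vecC φ.1)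
      (((l : ℝ) : ℂ) • vecC (basisZero n).1)
    rw [← hφ, ← vecC_add_single, hφ, rankOne_smul, rankOne_smul] at h
    convert h using 2
    simp only [mixture, map_add, Finsupp.linearCombination_single, ElemPure.proj_eq]
    congr 1 <;>
    · ext i j
      simp [Rat.smul_def]
      ring

theorem normSqQ_eq_trace {d : ℕ} (v : Fin d → GaussRat) :
    (rankOne (vecC v)).trace = ((normSqQ v : ℝ) : ℂ) := by
  simp only [trace, diag_apply, rankOne, vecMulVec_apply, Pi.star_apply, vecC, normSqQ]
  push_cast
  refine Finset.sum_congr rfl fun i _ => ?_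
  apply Complex.ext <;> simp [GaussRat.toComplex, ← Complex.ofReal_ratCast, ← Complex.ofReal_pow] <;> ring

theorem exists_mixture_sum {n : ℕ} (L : List (ℚ × (Fin (2 ^ n) → GaussRat)))
    (hL : ∀ e ∈ L, 0 ≤ e.1) :
    ∃ W : ElemPure n →₀ ℚ, (∀ φ, 0 ≤ W φ) ∧
      totalWeight W ≤ 10 * (L.map fun e => e.1 * normSqQ e.2).sum ∧
      (mixture W - (L.map fun e => ((e.1 : ℝ) : ℂ) • rankOne (vecC e.2)).sum).PosSemidef := by
  induction L with
  | nil => exact ⟨0, by simp, by simp, by simpa using PosSemidef.zero⟩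
  | cons e L ih =>
    obtain ⟨W, h1, h2, h3⟩ := ih fun e he => hL e (List.mem_cons_of_mem _ he)
    have h0 := hL e List.mem_cons_self
    obtain ⟨V, g1, g2, g3⟩ := exists_mixture_rankOne e.2
    refine ⟨e.1 • V + W, ?_, ?_, ?_⟩
    · intro φ
      rw [Finsupp.add_apply, Finsupp.smul_apply]
      exact add_nonneg (mul_nonneg h0 (g1 φ)) (h1 φ)
    · rw [map_add, map_smul, List.map_cons, List.sum_cons, smul_eq_mul]
      nlinarith
    · have hsm : ((e.1 : ℝ) : ℂ) • rankOne (vecC e.2) = e.1 • rankOne (vecC e.2) := by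
        ext i j
        simp [Rat.smul_def]
      rw [map_add, map_smul, List.map_cons, List.sum_cons, hsm]
      convert (g3.rat_smul h0).add h3 using 1
      rw [smul_sub]
      abel

/-- Every elementary semi-density matrix is dominated by a mixture of elementary pure states of
total weight at most `10`. -/
theorem exists_mixture_dominating {n : ℕ} (ρ : Matrix (Fin (2 ^ n)) (Fin (2 ^ n)) GaussRat)
    (hρ : IsSemiDensity (toC ρ)) :
    ∃ W : ElemPure n →₀ ℚ, (∀ φ, 0 ≤ W φ) ∧ totalWeight W ≤ 10 ∧
      (mixture W - toC ρ).PosSemidef := by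
  obtain ⟨L, hL, hsum⟩ := exists_gauss_decomposition hρ.1 fun i j => toComplex_mem_gaussField _
  obtain ⟨W, h1, h2, h3⟩ := exists_mixture_sum L hL
  refine ⟨W, h1, h2.trans ?_, ?_⟩
  · have htr : (((L.map fun e => e.1 * normSqQ e.2).sum : ℚ) : ℝ) = (toC ρ).trace.re := by
      rw [hsum]
      clear h2 h3 hsum hL
      induction L with
      | nil => simp
      | cons e L ih =>
        have := normSqQ_eq_trace e.2
        rw [List.map_cons, List.sum_cons, List.map_cons, List.sum_cons, Matrix.trace_add,
          Complex.add_re, Rat.cast_add, ih, trace_smul]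
        change _ = ((((e.1 : ℝ) : ℂ) • (rankOne (vecC e.2)).trace)).re + _
        rw [this]
        simp
    have h := hρ.2
    rw [← htr] at h
    have h' : (L.map fun e => e.1 * normSqQ e.2).sum ≤ 1 := by exact_mod_cast h
    linarith
  · rw [hsum]
    exact h3

end Mixtures

end

noncomputable section

/-! ### Existence and soundness of certificates -/

section Soundness

open Matrix

/-- Left end of the dyadic interval of a codeword. -/
def Codeword.lo (k : Codeword) : ℚ := k.2 / 2 ^ k.1

/-- Right end of the dyadic interval of a codeword. -/
def Codeword.hi (k : Codeword) : ℚ := (k.2 + 1) / 2 ^ k.1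

theorem Codeword.lo_lt_hi (k : Codeword) : k.lo < k.hi := by
  unfold lo hi
  gcongr
  linarith

/-- An extension of a codeword starts inside its dyadic interval. Disjoint intervals thus give
prefix-free codewords. -/
theorem Codeword.Le.interval {k k' : Codeword} (h : k.Le k') : k.lo ≤ k'.lo ∧ k'.lo < k.hi := by
  obtain ⟨l, a⟩ := k
  obtain ⟨l', a'⟩ := k'
  obtain ⟨h1, h2⟩ := h
  simp only at h1 h2
  obtain ⟨m, rfl⟩ := Nat.exists_eq_add_of_le h1
  rw [Nat.add_sub_cancel_left] at h2
  have h3 : a * 2 ^ m ≤ a' := h2 ▸ Nat.div_mul_le_self a' (2 ^ m)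
  have h4 : a' < (a + 1) * 2 ^ m := by
    rw [← h2]
    exact Nat.lt_mul_of_div_lt (Nat.lt_succ_self _) (by positivity)
  have h3' : (a : ℚ) * 2 ^ m ≤ a' := by exact_mod_cast h3
  have h4' : (a' : ℚ) < (a + 1) * 2 ^ m := by exact_mod_cast h4
  unfold lo hi
  simp only [pow_add]
  constructor
  · rw [div_le_div_iff₀ (by positivity) (by positivity)]
    nlinarith [show (0 : ℚ) < 2 ^ l by positivity]
  · rw [div_lt_div_iff₀ (by positivity) (by positivity)]
    nlinarith [show (0 : ℚ) < 2 ^ l by positivity]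

/-- Codewords for positive weights of total at most `1`, with disjoint dyadic intervals. -/
theorem exists_codewords {β : Type*} (w : β → ℚ) (l : List β) (hpos : ∀ b ∈ l, 0 < w b) (F : ℚ)
    (hF : 0 ≤ F) (hle : F + (l.map w).sum ≤ 1) :
    ∃ T : List (Codeword × β), T.map Prod.snd = l ∧
      (∀ e ∈ T, w e.2 ≤ 4 * (1 / 2) ^ e.1.1 ∧ e.1.2 < 2 ^ e.1.1 ∧ F ≤ e.1.lo) ∧
      T.Pairwise fun e f => e.1.hi ≤ f.1.lo := by
  induction l generalizing F with
  | nil => exact ⟨[], rfl, by simp, List.Pairwise.nil⟩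
  | cons b l ih =>
    have hb := hpos b List.mem_cons_self
    rw [List.map_cons, List.sum_cons] at hle
    have hl : 0 ≤ (l.map w).sum := List.sum_nonneg fun x hx => by
      obtain ⟨c, hc, rfl⟩ := List.mem_map.1 hx
      exact (hpos c (List.mem_cons_of_mem _ hc)).le
    obtain ⟨T, h1, h2, h3⟩ := ih (fun c hc => hpos c (List.mem_cons_of_mem _ hc)) (F + w b)
      (by linarith) (by linarith)
    -- With 2^(-m-1) < w ≤ 2^(-m), take length m + 2. Rounding F up to the grid and then appending
    -- one grid interval costs less than 2 · 2^(-m-2) < w, so the interval ends before F + w. This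
    -- is the origin of the factor 4.
    obtain ⟨m, hm1, hm2⟩ := exists_nat_pow_near_of_lt_one hb (by linarith : w b ≤ 1)
      (by norm_num : (0 : ℚ) < 1 / 2) (by norm_num)
    have hP : (0 : ℚ) < 2 ^ (m + 2) := by positivity
    have hhalf : ((1 : ℚ) / 2) ^ (m + 2) = 1 / 2 ^ (m + 2) := by rw [div_pow, one_pow]
    have ha1 := Nat.le_ceil (F * 2 ^ (m + 2))
    have ha2 := Nat.ceil_lt_add_one (show 0 ≤ F * 2 ^ (m + 2) by positivity)
    have hw : 2 / 2 ^ (m + 2) < w b := by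
      rw [pow_succ] at hm1
      calc (2 : ℚ) / 2 ^ (m + 2) = 2 * (1 / 2) ^ (m + 2) := by rw [hhalf]; ring
        _ = (1 / 2) ^ m * (1 / 2) := by rw [pow_add]; ring
        _ < w b := hm1
    have hhi : Codeword.hi (m + 2, ⌈F * 2 ^ (m + 2)⌉₊) ≤ F + w b := by
      unfold Codeword.hi
      rw [div_lt_iff₀ hP] at hw
      rw [div_le_iff₀ hP, add_mul]
      simp only
      linarith
    refine ⟨((m + 2, ⌈F * 2 ^ (m + 2)⌉₊), b) :: T, by rw [List.map_cons, h1], ?_, ?_⟩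
    · intro e he
      rcases List.mem_cons.1 he with rfl | he
      · refine ⟨?_, ?_, ?_⟩
        · refine hm2.trans (le_of_eq ?_)
          simp only [pow_add]
          ring
        · have h4 : Codeword.hi (m + 2, ⌈F * 2 ^ (m + 2)⌉₊) ≤ 1 := by linarith
          unfold Codeword.hi at h4
          rw [div_le_one hP] at h4
          have h5 : ⌈F * 2 ^ (m + 2)⌉₊ + 1 ≤ 2 ^ (m + 2) := by exact_mod_cast h4
          exact h5
        · unfold Codeword.lo
          rw [le_div_iff₀ hP]
          exact ha1
      · obtain ⟨g1, g2, g3⟩ := h2 e he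
        exact ⟨g1, g2, by linarith⟩
    · exact List.pairwise_cons.2 ⟨fun e he => hhi.trans (h2 e he).2.2, h3⟩

/-- The vector of the first `d` entries of a list. -/
def vecOfList (d : ℕ) (u : List GaussRat) : Fin d → GaussRat := fun i => u.getD i 0

theorem vecOfList_ofFn {d : ℕ} (v : Fin d → GaussRat) : vecOfList d (List.ofFn v) = v := by
  funext i
  simp [vecOfList, List.getD_eq_getElem?_getD]

theorem ofFn_vecOfList {d : ℕ} {u : List GaussRat} (h : u.length = d) :
    List.ofFn (vecOfList d u) = u := by
  subst h
  refine List.ext_getElem (by simp) fun i h1 h2 => ?_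
  simp [vecOfList, List.getD_eq_getElem?_getD, h2]

theorem listNormSq_ofFn {d : ℕ} (v : Fin d → GaussRat) : listNormSq (List.ofFn v) = normSqQ v := by
  simp [listNormSq, normSqQ, List.map_ofFn, List.sum_ofFn, pow_two]

theorem toComplex_gramEntry {d : ℕ} (L : List (ℚ × List GaussRat)) (i j : Fin d) :
    (gramEntry L i j).toComplex =
      (L.map fun e => ((e.1 : ℝ) : ℂ) • rankOne (vecC (vecOfList d e.2))).sum i j := by
  induction L with
  | nil => apply Complex.ext <;> simp [gramEntry, GaussRat.toComplex]
  | cons e L ih =>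
    rw [List.map_cons, List.sum_cons, Matrix.add_apply, ← ih, gramEntry, List.map_cons, List.sum_cons,
      GaussRat.toComplex_add, GaussRat.toComplex_scale, GaussRat.toComplex_mulConj, ← gramEntry]
    simp [rankOne, vecMulVec_apply, vecC, vecOfList]

theorem matRows_getD {d : ℕ} (A : Matrix (Fin d) (Fin d) GaussRat) (i j : Fin d) :
    ((matRows A).getD i []).getD j 0 = A i j := by
  simp [matRows, List.getD_eq_getElem?_getD]

theorem rat_smul_eq {d : ℕ} (c : ℚ) (A : Matrix (Fin d) (Fin d) ℂ) :
    ((c : ℝ) : ℂ) • A = c • A := by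
  ext i j
  simp [Rat.smul_def]

theorem CodeTable.separated_of_pairwise {T : CodeTable}
    (h1 : (T.map Prod.snd).Nodup) (h2 : T.Pairwise fun e f => e.1.hi ≤ f.1.lo) : T.Separated := by
  intro i hi j hj
  by_cases hij : i = j
  · exact Or.inl hij
  right
  rw [List.getD_eq_getElem _ _ hi, List.getD_eq_getElem _ _ hj]
  have hne : T[i].2 ≠ T[j].2 := by
    rw [List.nodup_iff_injective_get] at h1
    intro h
    have := @h1 ⟨i, by simpa using hi⟩ ⟨j, by simpa using hj⟩ (by simpa using h)
    exact hij (by simpa using this)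
  refine ⟨hne, fun hle => ?_⟩
  have hint := hle.interval
  rw [List.pairwise_iff_getElem] at h2
  rcases lt_or_gt_of_ne hij with hlt | hgt
  · have := h2 i j hi hj hlt
    linarith [hint.2]
  · have := h2 j i hj hi hgt
    linarith [hint.1, T[j].1.lo_lt_hi]

theorem CodeTable.Separated.nodup {T : CodeTable} (h : T.Separated) :
    (T.map Prod.snd).Nodup := by
  rw [List.nodup_iff_injective_get]
  rintro ⟨i, hi⟩ ⟨j, hj⟩ heq
  have hi' : i < T.length := by simpa using hi
  have hj' : j < T.length := by simpa using hj
  rcases h i hi' j hj' with hij | ⟨hne, -⟩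
  · exact Fin.ext hij
  · rw [List.getD_eq_getElem _ _ hi', List.getD_eq_getElem _ _ hj'] at hne
    exact absurd (by simpa using heq) hne

theorem posSemidef_list_sum {ι : Type*} {d : ℕ} {L : List ι} {f : ι → Matrix (Fin d) (Fin d) ℂ}
    (h : ∀ e ∈ L, (f e).PosSemidef) : (L.map f).sum.PosSemidef := by
  induction L with
  | nil => exact PosSemidef.zero
  | cons e L ih =>
    rw [List.map_cons, List.sum_cons]
    exact (h e List.mem_cons_self).add (ih fun e he => h e (List.mem_cons_of_mem _ he))

theorem list_sum_mem_gaussField {ι : Type*} {d : ℕ} (L : List ι)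
    {f : ι → Matrix (Fin d) (Fin d) ℂ} (i j : Fin d) (h : ∀ e ∈ L, f e i j ∈ gaussField) :
    (L.map f).sum i j ∈ gaussField := by
  induction L with
  | nil => exact gaussField.zero_mem
  | cons e L ih =>
    rw [List.map_cons, List.sum_cons]
    exact gaussField.add_mem (h e List.mem_cons_self)
      (ih fun e he => h e (List.mem_cons_of_mem _ he))

/-- The weights of a dominating mixture, divided by 10, are coded to give the table. The excess of
the coded weights over ρ is positive semidefinite with Gaussian rational entries, so it decomposes
in turn; this supplies the second half of the certificate. -/
theorem exists_certifies {n : ℕ} (ρ : Matrix (Fin (2 ^ n)) (Fin (2 ^ n)) GaussRat)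
    (hρ : IsSemiDensity (toC ρ)) : ∃ C, Certifies (matRows ρ) C := by
  obtain ⟨W, hW0, hW1, hW2⟩ := exists_mixture_dominating ρ hρ
  have hmix : mixture W = (W.support.toList.map fun φ => W φ • φ.proj).sum := by
    rw [mixture, Finsupp.linearCombination_apply, Finsupp.sum, Finset.sum_map_toList]
  have htot : totalWeight W = (W.support.toList.map W).sum := by
    rw [totalWeight, Finsupp.linearCombination_apply, Finsupp.sum, Finset.sum_map_toList]
    simp
  obtain ⟨T, hT1, hT2, hT3⟩ := exists_codewords (fun φ => W φ / 10) W.support.toList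
    (fun φ hφ => by
      have h1 : W φ ≠ 0 := by simpa using hφ
      have := lt_of_le_of_ne (hW0 φ) h1.symm
      positivity) 0 le_rfl (by
      have : (W.support.toList.map fun φ => W φ / 10).sum = totalWeight W / 10 := by
        rw [htot]
        simp only [div_eq_mul_inv, List.sum_map_mul_right]
      rw [this]
      linarith)
  set M : Matrix (Fin (2 ^ n)) (Fin (2 ^ n)) ℂ :=
    (T.map fun e => (40 * (1 / 2) ^ e.1.1 : ℚ) • e.2.proj).sum - toC ρ with hM
  have hMpos : M.PosSemidef := by
    -- The excess is what rounding to codeword weights adds, plus the excess of the mixture itself.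
    have h : M = (T.map fun e => (40 * (1 / 2) ^ e.1.1 - W e.2 : ℚ) • e.2.proj).sum +
        (mixture W - toC ρ) := by
      rw [hmix, ← hT1, List.map_map, hM, ← add_sub_assoc, Function.comp_def, ← List.sum_map_add]
      simp only [← add_smul, sub_add_cancel]
    rw [h]
    refine PosSemidef.add (posSemidef_list_sum fun e he => (posSemidef_proj _).rat_smul ?_) hW2
    have := (hT2 e he).1
    linarith
  obtain ⟨L, hL0, hL⟩ := exists_gauss_decomposition hMpos fun i j => by
    rw [hM]
    refine gaussField.sub_mem (list_sum_mem_gaussField _ i j fun e _ => ?_)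
      (toComplex_mem_gaussField _)
    rw [← rat_smul_eq]
    refine gaussField.mul_mem (ratCast_mem_gaussField _) ?_
    rw [← show GaussRat.toComplex ((e.2.1 i).mulConj (e.2.1 j)) = e.2.proj i j from
      GaussRat.toComplex_mulConj _ _]
    exact toComplex_mem_gaussField _
  have hlen : (matRows ρ).length = 2 ^ n := by simp [matRows]
  have hnodup : (T.map Prod.snd).Nodup := hT1 ▸ W.support.nodup_toList
  refine ⟨(T.map fun e => (e.1, List.ofFn e.2.1), L.map fun e => (e.1, List.ofFn e.2)),
    ?_, ?_, ?_, ?_⟩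
  · intro e he
    obtain ⟨f, hf, rfl⟩ := List.mem_map.1 he
    refine ⟨(hT2 f hf).2.1, by simp [hlen], ?_⟩
    rw [listNormSq_ofFn]
    exact f.2.2
  · refine CodeTable.separated_of_pairwise ?_ ?_
    · rw [List.map_map]
      have : (Prod.snd ∘ fun e : Codeword × ElemPure n => (e.1, List.ofFn e.2.1)) =
          (fun φ : ElemPure n => List.ofFn φ.1) ∘ Prod.snd := rfl
      rw [this, ← List.map_map]
      exact hnodup.map fun φ ψ h => Subtype.ext (List.ofFn_injective h)
    · rw [List.pairwise_map]
      exact hT3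
  · intro u hu
    obtain ⟨f, hf, rfl⟩ := List.mem_map.1 hu
    exact hL0 f hf
  · intro i hi j hj
    rw [hlen] at hi hj
    have hij := congrFun (congrFun hL ⟨i, hi⟩) ⟨j, hj⟩
    apply GaussRat.toComplex_injective
    rw [GaussRat.toComplex_add, matRows_getD ρ ⟨i, hi⟩ ⟨j, hj⟩,
      toComplex_gramEntry _ ⟨i, hi⟩ ⟨j, hj⟩, toComplex_gramEntry _ ⟨i, hi⟩ ⟨j, hj⟩, CodeTable.weighted]
    simp only [List.map_map, Function.comp_def, vecOfList_ofFn]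
    rw [hM, Matrix.sub_apply, sub_eq_iff_eq_add'] at hij
    simp only [rat_smul_eq]
    simp only [rat_smul_eq] at hij
    exact hij.symm

/-- Soundness for any certificate that the search may hit. Unit norms turn table entries into
elementary pure states, and the entrywise identity exhibits the difference as a sum of positive
semidefinite matrices. -/
theorem Certifies.exists_dominating {n : ℕ} {ρ : Matrix (Fin (2 ^ n)) (Fin (2 ^ n)) GaussRat}
    {C : Certificate} (h : Certifies (matRows ρ) C) :
    ∃ X : List (Codeword × ElemPure n), (∀ e ∈ X, (e.1, List.ofFn e.2.1) ∈ C.1) ∧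
      (X.map Prod.snd).Nodup ∧
      ((X.map fun e => (40 * (1 / 2) ^ e.1.1 : ℚ) • e.2.proj).sum - toC ρ).PosSemidef := by
  obtain ⟨h1, h2, h3, h4⟩ := h
  have hlen : (matRows ρ).length = 2 ^ n := by simp [matRows]
  rw [hlen] at h1 h4
  obtain ⟨X, hX⟩ : ∃ X : List (Codeword × ElemPure n),
      X.map (fun e => (e.1, List.ofFn e.2.1)) = C.1 := by
    rw [← Set.mem_range, Set.range_list_map]
    intro e he
    obtain ⟨-, g2, g3⟩ := h1 e he
    have hv := ofFn_vecOfList g2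
    refine ⟨(e.1, ⟨vecOfList _ e.2, ?_⟩), Prod.ext rfl hv⟩
    rwa [← hv, listNormSq_ofFn] at g3
  refine ⟨X, fun e he => hX ▸ List.mem_map.2 ⟨e, he, rfl⟩, ?_, ?_⟩
  · have := h2.nodup
    rw [← hX, List.map_map] at this
    exact List.Nodup.of_map (fun φ : ElemPure n => List.ofFn φ.1)
      (by rw [List.map_map]; exact this)
  · have heq : (X.map fun e => (40 * (1 / 2) ^ e.1.1 : ℚ) • e.2.proj).sum - toC ρ =
        (C.2.map fun e => e.1 • rankOne (vecC (vecOfList (2 ^ n) e.2))).sum := by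
      ext i j
      have hij := congrArg GaussRat.toComplex (h4 i i.2 j j.2)
      rw [GaussRat.toComplex_add, matRows_getD, toComplex_gramEntry, toComplex_gramEntry,
        CodeTable.weighted, ← hX] at hij
      simp only [List.map_map, Function.comp_def, vecOfList_ofFn, rat_smul_eq] at hij
      rw [Matrix.sub_apply, sub_eq_iff_eq_add']
      exact hij.symm
    rw [heq]
    exact posSemidef_list_sum fun e he => (posSemidef_rankOne _).rat_smul (h3 e he)

end Soundness

end

noncomputable section

/-! ### The Kraft inequality for programs -/

section Kraft

open InformationTheory

theorem uniquelyDecodable_of_prefixFree {S : Set (List Bool)} (h0 : [] ∉ S)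
    (h : ∀ p ∈ S, ∀ p' ∈ S, p <+: p' → p = p') : UniquelyDecodable S := by
  intro L₁
  induction L₁ with
  | nil =>
    intro L₂ _ h2 heq
    cases L₂ with
    | nil => rfl
    | cons w L₂ =>
      have hw := h2 w List.mem_cons_self
      simp only [List.flatten_nil, List.flatten_cons, List.nil_eq, List.append_eq_nil_iff] at heq
      exact absurd (heq.1 ▸ hw) h0
  | cons v L₁ ih =>
    intro L₂ h1 h2 heq
    have hv := h1 v List.mem_cons_self
    cases L₂ with
    | nil =>
      simp only [List.flatten_nil, List.flatten_cons, List.append_eq_nil_iff] at heq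
      exact absurd (heq.1 ▸ hv) h0
    | cons w L₂ =>
      have hw := h2 w List.mem_cons_self
      rw [List.flatten_cons, List.flatten_cons] at heq
      have hvw : v = w := by
        rcases List.prefix_or_prefix_of_prefix (l₁ := v) (l₂ := w) (l₃ := v ++ L₁.flatten)
          (List.prefix_append _ _) (heq ▸ List.prefix_append _ _) with hp | hp
        · exact h v hv w hw hp
        · exact (h w hw v hv hp).symm
      subst hvw
      rw [ih L₂ (fun u hu => h1 u (List.mem_cons_of_mem _ hu))
        (fun u hu => h2 u (List.mem_cons_of_mem _ hu)) (List.append_cancel_left heq)]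

theorem kraft_tsum_le_one {S : Set (List Bool)}
    (h : ∀ p ∈ S, ∀ p' ∈ S, p <+: p' → p = p') :
    ∑' p : S, (2⁻¹ : ℝ≥0∞) ^ p.1.length ≤ 1 := by
  -- A uniquely decodable set excludes the empty word. If it is present, prefix-freeness makes it
  -- the only member and the sum is 1; otherwise Kraft–McMillan bounds every finite partial sum.
  by_cases h0 : [] ∈ S
  · have hS : ∀ p : S, p = ⟨[], h0⟩ := fun p =>
      Subtype.ext (h [] h0 p.1 p.2 List.nil_prefix).symm
    rw [tsum_eq_single ⟨[], h0⟩ fun p hp => absurd (hS p) hp]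
    simp
  · rw [ENNReal.tsum_eq_iSup_sum]
    refine iSup_le fun s => ?_
    classical
    have hud : UniquelyDecodable ((s.map (Function.Embedding.subtype _) : Finset (List Bool)) :
        Set (List Bool)) :=
      uniquelyDecodable_of_prefixFree (by simp [h0]) fun p hp p' hp' =>
        h p (by simp at hp; exact hp.1) p' (by simp at hp'; exact hp'.1)
    have hk := kraft_mcmillan_inequality hud
    rw [Finset.sum_map] at hk
    simp only [Fintype.card_bool, Function.Embedding.subtype_apply] at hk
    have : ∑ p ∈ s, (2⁻¹ : ℝ≥0∞) ^ p.1.length =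
        ENNReal.ofReal (∑ p ∈ s, (1 / (2 : ℕ) : ℝ) ^ p.1.length) := by
      rw [ENNReal.ofReal_sum_of_nonneg fun _ _ => by positivity]
      refine Finset.sum_congr rfl fun p _ => ?_
      rw [ENNReal.ofReal_pow (by positivity)]
      congr 1
      rw [one_div, ENNReal.ofReal_inv_of_pos (by norm_num)]
      simp
    rw [this]
    exact ENNReal.ofReal_le_one.2 hk

end Kraft

/-! ### Halting programs form a prefix-free set -/

namespace PrefixMachine

theorem iterate_step_append (U : PrefixMachine) (t : ℕ) (c c' : U.Cfg) (p w o o' : List Bool)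
    (h : U.step^[t] (c, p, o) = (c', [], o')) (hc' : U.halts c' = true) :
    U.step^[t] (c, p ++ w, o) = (c', w, o') := by
  induction t generalizing c p o with
  | zero =>
    simp only [Function.iterate_zero, id, Prod.mk.injEq] at h ⊢
    obtain ⟨rfl, rfl, rfl⟩ := h
    simp
  | succ t ih =>
    rw [Function.iterate_succ_apply] at h ⊢
    cases hc : U.halts c with
    | true =>
      have h1 : ∀ q, U.step (c, q, o) = (c, q, o) := fun q => by simp [step, hc]
      rw [h1] at h ⊢
      exact ih _ _ _ h
    | false =>
      cases hr : U.reads c with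
      | false =>
        have h1 : ∀ q, U.step (c, q, o) = (U.next c none, q, o ++ U.write c) := fun q => by
          simp [step, hc, hr]
        rw [h1] at h ⊢
        exact ih _ _ _ h
      | true =>
        cases p with
        | nil =>
          -- A starved machine would stay put forever, contradicting that it halts.
          have h1 : U.step (c, [], o) = (c, [], o) := by simp [step, hc, hr]
          rw [h1, Function.iterate_fixed h1] at h
          simp only [Prod.mk.injEq] at h
          rw [h.1, hc'] at hc
          exact absurd hc (by simp)
        | cons b p =>
          have h1 : ∀ q, U.step (c, b :: q, o) = (U.next c (some b), q, o ++ U.write c) :=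
            fun q => by simp [step, hc, hr]
          rw [List.cons_append, h1]
          rw [h1] at h
          exact ih _ _ _ h

theorem run_of_halts {U : PrefixMachine} {y p : List Bool} {t t' : ℕ}
    (h : U.halts (U.run y p t).1 = true) (ht : t ≤ t') : U.run y p t' = U.run y p t := by
  obtain ⟨k, rfl⟩ := Nat.exists_eq_add_of_le' ht
  rw [run, Function.iterate_add_apply]
  change U.step^[k] (U.run y p t) = _
  exact Function.iterate_fixed (by rw [step, if_pos h]) k

/-- Both runs can be read off the same longer tape. By determinism they end in the same situation,
where `w` is unread according to one and nothing is unread according to the other. -/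
theorem Outputs.eq_of_prefix {U : PrefixMachine} {y p p' x x' : List Bool}
    (h : U.Outputs y p x) (h' : U.Outputs y p' x') (hp : p <+: p') : p = p' ∧ x = x' := by
  obtain ⟨w, rfl⟩ := hp
  obtain ⟨t, h1, h2, h3⟩ := h
  obtain ⟨t', h1', h2', h3'⟩ := h'
  have hrun : U.step^[t] (U.init y, p, []) = ((U.run y p t).1, [], x) :=
    Prod.ext rfl (Prod.ext h2 h3)
  have happ : U.run y (p ++ w) t = ((U.run y p t).1, w, x) :=
    U.iterate_step_append t _ _ p w _ _ hrun h1
  have e : U.run y (p ++ w) t' = U.run y (p ++ w) t := by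
    rcases le_total t t' with hle | hle
    · exact run_of_halts (by rw [happ]; exact h1) hle
    · exact (run_of_halts h1' hle).symm
  rw [e, happ] at h2' h3'
  simp only at h2' h3'
  exact ⟨by rw [h2', List.append_nil], h3'⟩

/-- Each program has at most one output, so the double sum over outputs and programs embeds in the
Kraft sum of all halting programs. -/
theorem tsum_m_le_one (U : PrefixMachine) (y : List Bool) : ∑' x, U.m x y ≤ 1 := by
  let S : Set (List Bool) := {p | ∃ x, U.Outputs y p x}
  have hS : ∑' p : S, (2⁻¹ : ℝ≥0∞) ^ p.1.length ≤ 1 :=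
    kraft_tsum_le_one fun p ⟨_, hp⟩ p' ⟨_, hp'⟩ hpre => (hp.eq_of_prefix hp' hpre).1
  refine le_trans ?_ hS
  have : ∑' x, U.m x y = ∑' s : Σ x, {p : List Bool // U.Outputs y p x},
      (2⁻¹ : ℝ≥0∞) ^ s.2.1.length := by
    rw [ENNReal.tsum_sigma']
    rfl
  rw [this]
  refine ENNReal.tsum_comp_le_tsum_of_injective
    (f := fun s : Σ x, {p : List Bool // U.Outputs y p x} => (⟨s.2.1, s.1, s.2.2⟩ : S)) ?_
    fun p : S => (2⁻¹ : ℝ≥0∞) ^ p.1.length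
  rintro ⟨x, p, hp⟩ ⟨x', p', hp'⟩ h
  obtain rfl : p = p' := congrArg Subtype.val h
  obtain rfl := (hp.eq_of_prefix hp' List.prefix_rfl).2
  rfl

theorem m_le_one (U : PrefixMachine) (x y : List Bool) : U.m x y ≤ 1 :=
  (ENNReal.le_tsum x).trans (U.tsum_m_le_one y)

theorem pow_le_m {U : PrefixMachine} {x y : List Bool} {k : ℕ} (h : U.K x y ≤ k) :
    (2⁻¹ : ℝ≥0∞) ^ k ≤ U.m x y := by
  obtain ⟨j, hj⟩ := ENat.ne_top_iff_exists.1 (ne_top_of_le_ne_top (ENat.natCast_ne_top k) h)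
  obtain ⟨p, hp, hlen⟩ := exists_outputs_of_K_eq hj.symm
  rw [← hj] at h
  have hjk : j ≤ k := by exact_mod_cast h
  refine le_trans ?_ (ENNReal.le_tsum (⟨p, hp⟩ : {p : List Bool // U.Outputs y p x}))
  rw [hlen]
  exact pow_le_pow_of_le_one zero_le (ENNReal.inv_le_one.2 (by norm_num)) hjk

end PrefixMachine

/-! ### A program lower computes at most one matrix -/

section Printing

theorem natStr_append_prefix {a b : ℕ} {r r' : List Bool}
    (h : natStr a ++ r <+: natStr b ++ r') : a = b ∧ r <+: r' := by
  induction a generalizing b with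
  | zero =>
    cases b with
    | zero => simpa [natStr] using h
    | succ b => simp [natStr, List.replicate_succ] at h
  | succ a ih =>
    cases b with
    | zero => simp [natStr, List.replicate_succ] at h
    | succ b =>
      have := @ih b (by simpa [natStr, List.replicate_succ] using h)
      exact ⟨by rw [this.1], this.2⟩

theorem natStr_injective : Function.Injective natStr := fun a b h =>
  (natStr_append_prefix (r := []) (r' := []) (by rw [h])).1

/-- Unary blocks with terminator are self-delimiting, so the output tape parses in only one way. -/
theorem flatten_natStr_prefix {w w' : ℕ → ℕ} {k k' : ℕ}
    (h : ((List.range k).map fun i => natStr (w i)).flatten <+: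
      ((List.range k').map fun i => natStr (w' i)).flatten) :
    k ≤ k' ∧ ∀ i < k, w i = w' i := by
  induction k generalizing w w' k' with
  | zero => simp
  | succ k ih =>
    cases k' with
    | zero => simp [List.range_succ_eq_map, natStr] at h
    | succ k' =>
      rw [List.range_succ_eq_map, List.range_succ_eq_map, List.map_cons, List.map_cons,
        List.flatten_cons, List.flatten_cons, List.map_map, List.map_map] at h
      obtain ⟨h0, h1⟩ := natStr_append_prefix h
      obtain ⟨g1, g2⟩ := ih (w := fun i => w (i + 1)) (w' := fun i => w' (i + 1)) h1
      refine ⟨by omega, fun i hi => ?_⟩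
      cases i with
      | zero => exact h0
      | succ i => exact g2 i (by omega)

theorem matRows_injective {d : ℕ} : Function.Injective (matRows (d := d)) := fun A B h => by
  have := List.ofFn_injective h
  funext i j
  exact congrFun (List.ofFn_injective (congrFun this i)) j

theorem vecStr_injective {d : ℕ} : Function.Injective (vecStr (d := d)) := fun v v' h => by
  rw [vecStr_eq_listStr, vecStr_eq_listStr, listStr, listStr, encode_map_gaussCode,
    encode_map_gaussCode] at h
  exact List.ofFn_injective
    ((Primcodable.list (α := GaussRat)).toEncodable.encode_injective (natStr_injective h))

namespace PrefixMachine

theorem Prints.agree {U : PrefixMachine} {q : List Bool} {L L' : ℕ∞} {w w' : ℕ → ℕ}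
    (h : U.Prints q L fun i => natStr (w i)) (h' : U.Prints q L' fun i => natStr (w' i))
    (k : ℕ) (hk : (k : ℕ∞) ≤ L) : (k : ℕ∞) ≤ L' ∧ ∀ i < k, w i = w' i := by
  obtain ⟨t, ht⟩ := h.2 k hk
  obtain ⟨k', hk', ht'⟩ := h'.1 t
  obtain ⟨g1, g2⟩ := flatten_natStr_prefix (ht.trans ht')
  exact ⟨le_trans (by exact_mod_cast g1) hk', g2⟩

/-- The tape determines the printed matrices and their number, and a finite sequence continues by
its last member. The limits therefore agree, and no program is counted for two matrices. -/
theorem LowerComputes.unique {U : PrefixMachine} {d : ℕ} {q : List Bool}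
    {σ σ' : Matrix (Fin d) (Fin d) ℂ} (h : U.LowerComputes q σ) (h' : U.LowerComputes q σ') :
    σ = σ' := by
  obtain ⟨-, L, s, hL, hp, hs, -, -, hlim⟩ := h
  obtain ⟨-, L', s', hL', hp', hs', -, -, hlim'⟩ := h'
  simp only [matStr_eq] at hp hp'
  have h1 := hp.agree hp'
  have h2 := hp'.agree hp
  have hag : ∀ i : ℕ, ((i + 1 : ℕ) : ℕ∞) ≤ L → s i = s' i := fun i hi =>
    matRows_injective ((Primcodable.list (α := List GaussRat)).toEncodable.encode_injective
      ((h1 (i + 1) hi).2 i (Nat.lt_succ_self i)))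
  have hss : ∀ i, s i = s' i := by
    intro i
    induction i with
    | zero => exact hag 0 (by simpa using hL)
    | succ i ih =>
      by_cases hi : ((i + 1 + 1 : ℕ) : ℕ∞) ≤ L
      · exact hag _ hi
      · have hi' : ¬ ((i + 1 + 1 : ℕ) : ℕ∞) ≤ L' := fun hc => hi (h2 _ hc).1
        have key : ∀ M : ℕ∞, ¬ ((i + 1 + 1 : ℕ) : ℕ∞) ≤ M → M ≤ ((i + 1 : ℕ) : ℕ∞) := by
          intro M hM
          rw [not_le] at hM
          refine ENat.lt_add_one_iff (ENat.natCast_ne_top _) |>.1 ?_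
          exact_mod_cast hM
        rw [hs i (key L hi), hs' i (key L' hi'), ih]
  obtain rfl : s = s' := funext hss
  exact tendsto_nhds_unique hlim hlim'

theorem LowerComputes.posSemidef {U : PrefixMachine} {d : ℕ} {q : List Bool}
    {σ : Matrix (Fin d) (Fin d) ℂ} (h : U.LowerComputes q σ)
    (hcl : IsClosed {A : Matrix (Fin d) (Fin d) ℂ | A.PosSemidef}) : σ.PosSemidef := by
  obtain ⟨-, L, s, -, -, -, hs, -, hlim⟩ := h
  exact hcl.mem_of_tendsto hlim (Filter.Eventually.of_forall hs)

theorem tsum_lowerM_le_one (U : PrefixMachine) {d : ℕ} (y : List Bool)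
    (S : Set (Matrix (Fin d) (Fin d) ℂ)) : ∑' E : S, U.lowerM E.1 y ≤ 1 := by
  refine le_trans ?_ (U.tsum_m_le_one y)
  have : ∑' E : S, U.lowerM E.1 y =
      ∑' s : Σ E : S, {q : List Bool // U.LowerComputes q E.1}, U.m s.2.1 y := by
    rw [ENNReal.tsum_sigma']
    rfl
  rw [this]
  refine ENNReal.tsum_comp_le_tsum_of_injective
    (f := fun s : Σ E : S, {q : List Bool // U.LowerComputes q E.1} => s.2.1) ?_
    fun q => U.m q y
  rintro ⟨⟨E, hE⟩, q, hq⟩ ⟨⟨E', hE'⟩, q', hq'⟩ h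
  obtain rfl : q = q' := h
  obtain rfl := hq.unique hq'
  rfl

end PrefixMachine

end Printing

end

noncomputable section

/-! ### Positive semidefinite matrices: closedness, traces and Kronecker products -/

section Loewner

open Matrix

theorem isClosed_posSemidef {d : ℕ} : IsClosed {A : Matrix (Fin d) (Fin d) ℂ | A.PosSemidef} := by
  simp only [posSemidef_iff_dotProduct_mulVec, Set.ofPred_and, Set.ofPred_forall]
  refine IsClosed.inter (isClosed_eq (by fun_prop) continuous_id) (isClosed_iInter fun x => ?_)
  refine isClosed_le continuous_const ?_
  fun_prop

theorem posSemidef_tsum_sub_sum {ι : Type*} {d : ℕ} {f : ι → Matrix (Fin d) (Fin d) ℂ}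
    (hf : ∀ i, (f i).PosSemidef) (hs : Summable f) (F : Finset ι) :
    (∑' i, f i - ∑ i ∈ F, f i).PosSemidef := by
  classical
  have hlim : Filter.Tendsto (fun s : Finset ι => ∑ i ∈ s, f i) Filter.atTop
      (nhds (∑' i, f i)) := hs.hasSum
  refine isClosed_posSemidef.mem_of_tendsto (hlim.sub_const (∑ i ∈ F, f i)) ?_
  filter_upwards [Filter.eventually_ge_atTop F] with s hFs
  rw [← Finset.sum_sdiff hFs, add_sub_cancel_right]
  exact posSemidef_sum _ fun i _ => hf i

theorem summable_matrix {ι : Type*} {d : ℕ} {f : ι → Matrix (Fin d) (Fin d) ℂ} {b : ι → ℝ}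
    (hb : Summable b) (h : ∀ e i j, ‖f e i j‖ ≤ b e) : Summable f := by
  have : Summable (fun e => (fun i j => f e i j : Fin d → Fin d → ℂ)) :=
    Pi.summable.2 fun i => Pi.summable.2 fun j => Summable.of_norm_bounded hb fun e => h e i j
  exact this

/-- By the rank-one decomposition of `A` over all of ℂ, the trace is a nonnegative combination of
values ⟨v, B v⟩. -/
theorem trace_mul_nonneg_of_posSemidef {d : ℕ} {A B : Matrix (Fin d) (Fin d) ℂ}
    (hA : A.PosSemidef) (hB : B.PosSemidef) : 0 ≤ (A * B).trace := by
  obtain ⟨L, hL, rfl⟩ := hA.exists_rankOne_decomposition ⊤ fun _ _ => Subfield.mem_top _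
  clear hA
  induction L with
  | nil => simp
  | cons e L ih =>
    rw [List.map_cons, List.sum_cons, add_mul, trace_add]
    refine add_nonneg ?_ (ih fun e he => hL e (List.mem_cons_of_mem _ he))
    rw [smul_mul, trace_smul, vecMulVec_mul, trace_vecMulVec, dotProduct_comm,
      ← dotProduct_mulVec]
    exact mul_nonneg (by exact_mod_cast (hL e List.mem_cons_self).1)
      (hB.dotProduct_mulVec_nonneg e.2)

/-- For |v⟩⟨v| this is |v_i||v_j| ≤ ‖v‖², and the rank-one decomposition extends it. It reduces
convergence of matrix series to bounds on traces. -/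
theorem norm_apply_le_trace {d : ℕ} {A : Matrix (Fin d) (Fin d) ℂ} (hA : A.PosSemidef)
    (i j : Fin d) : ‖A i j‖ ≤ A.trace.re := by
  obtain ⟨L, hL, rfl⟩ := hA.exists_rankOne_decomposition ⊤ fun _ _ => Subfield.mem_top _
  clear hA
  induction L with
  | nil => simp
  | cons e L ih =>
    rw [List.map_cons, List.sum_cons, trace_add, Complex.add_re, Matrix.add_apply]
    refine (norm_add_le _ _).trans
      (add_le_add ?_ (ih fun e he => hL e (List.mem_cons_of_mem _ he)))
    have h0 := (hL e List.mem_cons_self).1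
    have htr : (((e.1 : ℝ) : ℂ) • vecMulVec e.2 (star e.2)).trace.re =
        e.1 * ∑ k, ‖e.2 k‖ ^ 2 := by
      rw [trace_smul, trace_vecMulVec, smul_eq_mul, Complex.re_ofReal_mul, dotProduct,
        Complex.re_sum]
      congr 1
      refine Finset.sum_congr rfl fun k _ => ?_
      rw [Pi.star_apply, RCLike.star_def, Complex.mul_conj, Complex.normSq_eq_norm_sq]
      exact Complex.ofReal_re _
    have hle : ∀ k, ‖e.2 k‖ ^ 2 ≤ ∑ k, ‖e.2 k‖ ^ 2 := fun k =>
      Finset.single_le_sum (f := fun k => ‖e.2 k‖ ^ 2) (fun _ _ => by positivity)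
        (Finset.mem_univ k)
    rw [htr, Matrix.smul_apply, vecMulVec_apply, Pi.star_apply, smul_eq_mul, norm_mul, norm_mul,
      norm_star, Complex.norm_real, Real.norm_of_nonneg h0]
    refine mul_le_mul_of_nonneg_left ?_ h0
    nlinarith [hle i, hle j, sq_nonneg (‖e.2 i‖ - ‖e.2 j‖)]

theorem posSemidef_kron {d : ℕ} {A B : Matrix (Fin d) (Fin d) ℂ} (hA : A.PosSemidef)
    (hB : B.PosSemidef) : (kron A B).PosSemidef :=
  (hA.kronecker hB).submatrix _

theorem kron_apply {d : ℕ} (A B : Matrix (Fin d) (Fin d) ℂ) (i j : Fin (d * d)) :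
    kron A B i j = A (finProdFinEquiv.symm i).1 (finProdFinEquiv.symm j).1 *
      B (finProdFinEquiv.symm i).2 (finProdFinEquiv.symm j).2 := rfl

theorem kron_smul_smul {d : ℕ} (a b : ℂ) (A B : Matrix (Fin d) (Fin d) ℂ) :
    kron (a • A) (b • B) = (a * b) • kron A B := by
  ext i j
  simp only [kron_apply, Matrix.smul_apply, smul_eq_mul]
  ring

theorem kron_one_one {d : ℕ} : kron (1 : Matrix (Fin d) (Fin d) ℂ) 1 = 1 := by
  simp [kron]

/-- Change one factor at a time: X' ⊗ Y' - X ⊗ Y = (X' - X) ⊗ Y' + X ⊗ (Y' - Y). -/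
theorem posSemidef_kron_sub_kron {d : ℕ} {X X' Y Y' : Matrix (Fin d) (Fin d) ℂ}
    (hX : X.PosSemidef) (hY' : Y'.PosSemidef) (hXX : (X' - X).PosSemidef)
    (hYY : (Y' - Y).PosSemidef) : (kron X' Y' - kron X Y).PosSemidef := by
  have : kron X' Y' - kron X Y = kron (X' - X) Y' + kron X (Y' - Y) := by
    ext i j
    simp only [kron_apply, Matrix.sub_apply, Matrix.add_apply]
    ring
  rw [this]
  exact (posSemidef_kron hXX hY').add (posSemidef_kron hX hYY)

theorem trace_mul_kron_le {d : ℕ} {E : Matrix (Fin (d * d)) (Fin (d * d)) ℂ}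
    {X X' Y Y' : Matrix (Fin d) (Fin d) ℂ} (hE : E.PosSemidef)
    (hX : X.PosSemidef) (hY' : Y'.PosSemidef) (hXX : (X' - X).PosSemidef)
    (hYY : (Y' - Y).PosSemidef) :
    (E * kron X Y).trace.re ≤ (E * kron X' Y').trace.re := by
  have h := trace_mul_nonneg_of_posSemidef hE (posSemidef_kron_sub_kron hX hY' hXX hYY)
  rw [mul_sub, trace_sub, Complex.nonneg_iff, Complex.sub_re] at h
  linarith [h.1]

end Loewner

/-! ### The universal matrix and the universal product test -/

namespace PrefixMachine

open Matrix

theorem norm_proj_apply_le {n : ℕ} (φ : ElemPure n) (i j : Fin (2 ^ n)) : ‖φ.proj i j‖ ≤ 1 := by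
  refine (norm_apply_le_trace (posSemidef_proj φ) i j).trans ?_
  rw [ElemPure.proj_eq, normSqQ_eq_trace, show normSqQ φ.1 = 1 from φ.2]
  simp

theorem tsum_m_vecStr_le_one (U : PrefixMachine) (n : ℕ) :
    ∑' φ : ElemPure n, U.m (vecStr φ.1) (natStr n) ≤ 1 :=
  le_trans (ENNReal.tsum_comp_le_tsum_of_injective
    (f := fun φ : ElemPure n => vecStr φ.1)
    (fun _ _ h => Subtype.ext (vecStr_injective h)) fun x => U.m x (natStr n))
    (U.tsum_m_le_one _)

theorem summable_muTerm (U : PrefixMachine) (n : ℕ) : Summable (U.muTerm n) := by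
  refine summable_matrix (ENNReal.summable_toReal
    (ne_top_of_le_ne_top ENNReal.one_ne_top (U.tsum_m_vecStr_le_one n))) fun φ i j => ?_
  rw [muTerm, Matrix.smul_apply, norm_smul, Real.norm_of_nonneg ENNReal.toReal_nonneg]
  exact mul_le_of_le_one_right ENNReal.toReal_nonneg (norm_proj_apply_le φ i j)

theorem real_smul_eq {d : ℕ} (c : ℝ) (A : Matrix (Fin d) (Fin d) ℂ) : c • A = (c : ℂ) • A := by
  ext i j
  simp

theorem posSemidef_real_smul {d : ℕ} {A : Matrix (Fin d) (Fin d) ℂ} (hA : A.PosSemidef) {c : ℝ}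
    (hc : 0 ≤ c) : (c • A).PosSemidef := by
  rw [real_smul_eq]
  exact hA.smul (by exact_mod_cast hc)

theorem posSemidef_muTerm (U : PrefixMachine) (n : ℕ) (φ : ElemPure n) :
    (U.muTerm n φ).PosSemidef :=
  posSemidef_real_smul (posSemidef_proj φ) ENNReal.toReal_nonneg

theorem posSemidef_mu (U : PrefixMachine) (n : ℕ) : (U.mu n).PosSemidef := by
  have := posSemidef_tsum_sub_sum (U.posSemidef_muTerm n) (U.summable_muTerm n) ∅
  rwa [Finset.sum_empty, sub_zero] at this

/-- The universal matrix dominates every elementary semi-density matrix, up to a factor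
exponential in its complexity. -/
theorem IsUniversal.exists_mu_dominates {U : PrefixMachine} (hU : U.IsUniversal) :
    ∃ c : ℕ, ∀ (n : ℕ) (ρ : Matrix (Fin (2 ^ n)) (Fin (2 ^ n)) GaussRat), IsSemiDensity (toC ρ) →
      ∀ k : ℕ, U.K (matStr ρ) (natStr n) = k →
        (((40 * 2 ^ (k + c) : ℝ)) • U.mu n - toC ρ).PosSemidef := by
  obtain ⟨c, hc⟩ := hU.exists_K_listStr_le
  refine ⟨c, fun n ρ hρ k hk => ?_⟩
  rw [matStr_eq] at hk
  obtain ⟨C, hC, hKC⟩ := hc (natStr n) _ k _ hk (rowsOfCode_encode _) (exists_certifies ρ hρ)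
  obtain ⟨X, hX1, hX2, hX3⟩ := hC.exists_dominating
  classical
  have hF := posSemidef_tsum_sub_sum (U.posSemidef_muTerm n) (U.summable_muTerm n)
    (X.map Prod.snd).toFinset
  -- The states of the table are distinct, so each term of μ is used at most once.
  rw [List.sum_toFinset _ hX2, List.map_map] at hF
  have hm : ∀ e ∈ X, (40 * (1 / 2) ^ e.1.1 : ℝ) ≤
      40 * 2 ^ (k + c) * (U.m (vecStr e.2.1) (natStr n)).toReal := fun e he => by
    have h1 := pow_le_m (hKC _ (hX1 e he))
    rw [← vecStr_eq_listStr] at h1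
    have h2 := ENNReal.toReal_mono (ne_top_of_le_ne_top ENNReal.one_ne_top (U.m_le_one _ _)) h1
    rw [ENNReal.toReal_pow, ENNReal.toReal_inv, ENNReal.toReal_ofNat] at h2
    have h3 : ((1 : ℝ) / 2) ^ e.1.1 = 2 ^ (k + c) * (2⁻¹ : ℝ) ^ (k + e.1.1 + c) := by
      rw [show k + e.1.1 + c = (k + c) + e.1.1 by ring, pow_add 2⁻¹ (k + c), ← mul_assoc,
        ← mul_pow]
      norm_num
    rw [h3, mul_assoc]
    gcongr
  -- Three positive semidefinite parts: the terms of μ outside the table, the surplus of the scaled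
  -- weights in μ over the table weights, and the excess shown by the certificate.
  have hsplit : (40 * 2 ^ (k + c) : ℝ) • U.mu n - toC ρ =
      (40 * 2 ^ (k + c) : ℝ) • (U.mu n - (X.map (U.muTerm n ∘ Prod.snd)).sum) +
      (X.map fun e => (40 * 2 ^ (k + c) * (U.m (vecStr e.2.1) (natStr n)).toReal -
        40 * (1 / 2) ^ e.1.1 : ℝ) • e.2.proj).sum +
      ((X.map fun e => (40 * (1 / 2) ^ e.1.1 : ℚ) • e.2.proj).sum - toC ρ) := by
    have h1 : (X.map fun e => (40 * 2 ^ (k + c) * (U.m (vecStr e.2.1) (natStr n)).toReal -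
        40 * (1 / 2) ^ e.1.1 : ℝ) • e.2.proj).sum +
        (X.map fun e => (40 * (1 / 2) ^ e.1.1 : ℚ) • e.2.proj).sum =
        (40 * 2 ^ (k + c) : ℝ) • (X.map (U.muTerm n ∘ Prod.snd)).sum := by
      rw [← List.sum_map_add, List.smul_sum, List.map_map]
      congr 1
      refine List.map_congr_left fun e _ => ?_
      rw [← rat_smul_eq, ← real_smul_eq, ← add_smul]
      simp only [Function.comp_apply, muTerm, smul_smul]
      congr 1
      push_cast
      ring
    rw [add_sub, add_assoc, h1, smul_sub]
    abel
  rw [hsplit]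
  refine ((posSemidef_real_smul hF (by positivity)).add
    (posSemidef_list_sum fun e he => ?_)).add hX3
  exact posSemidef_real_smul (posSemidef_proj _) (sub_nonneg.2 (hm e he))

/-- The maximally mixed state. -/
def maximallyMixed (n : ℕ) : Matrix (Fin (2 ^ n)) (Fin (2 ^ n)) GaussRat :=
  fun i j => if i = j then (1 / 2 ^ n, 0) else 0

theorem toC_maximallyMixed (n : ℕ) : toC (maximallyMixed n) = (1 / 2 ^ n : ℝ) • 1 := by
  ext i j
  rcases eq_or_ne i j with rfl | h
  · rw [real_smul_eq]
    apply Complex.ext <;>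
      simp [toC, maximallyMixed, GaussRat.toComplex, -Complex.ofReal_inv, -Complex.ofReal_pow]
  · apply Complex.ext <;> simp [toC, maximallyMixed, GaussRat.toComplex, h]

theorem isSemiDensity_maximallyMixed (n : ℕ) : IsSemiDensity (toC (maximallyMixed n)) := by
  rw [toC_maximallyMixed]
  refine ⟨posSemidef_real_smul PosSemidef.one (by positivity), ?_⟩
  rw [trace_smul, trace_one, Fintype.card_fin]
  simp [← Complex.ofReal_pow, ← Complex.ofReal_ofNat]

/-- Domination applied to the maximally mixed state. Here ε may depend on n, since it serves only
for convergence. -/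
theorem IsUniversal.exists_mu_lower_bound {U : PrefixMachine} (hU : U.IsUniversal) (n : ℕ) :
    ∃ ε : ℝ, 0 < ε ∧ (U.mu n - ε • 1).PosSemidef := by
  obtain ⟨c, hc⟩ := hU.exists_mu_dominates
  obtain ⟨k, hk⟩ := ENat.ne_top_iff_exists.1 (hU.K_ne_top (matStr (maximallyMixed n)) (natStr n))
  have h := hc n _ (isSemiDensity_maximallyMixed n) k hk.symm
  refine ⟨(40 * 2 ^ (k + c))⁻¹ * (1 / 2 ^ n), by positivity, ?_⟩
  have h2 := posSemidef_real_smul h (c := (40 * 2 ^ (k + c))⁻¹) (by positivity)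
  rwa [toC_maximallyMixed, smul_sub, smul_smul, smul_smul, inv_mul_cancel₀ (by positivity),
    one_smul] at h2

theorem posSemidef_of_mem_productTests {U : PrefixMachine} {d : ℕ}
    {C D : Matrix (Fin d) (Fin d) ℂ} (E : U.ProductTests C D) : E.1.PosSemidef := by
  obtain ⟨-, ⟨q, hq⟩, -⟩ := E.2
  exact hq.posSemidef isClosed_posSemidef

/-- From μ ≥ ε · 1 one gets ε² Tr E ≤ Tr E(μ ⊗ μ) ≤ 1. -/
theorem IsUniversal.exists_trace_test_le {U : PrefixMachine} (hU : U.IsUniversal) (n : ℕ) :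
    ∃ B : ℝ, ∀ E : U.ProductTests (U.mu n) (U.mu n), E.1.trace.re ≤ B := by
  obtain ⟨ε, hε, hmu⟩ := hU.exists_mu_lower_bound n
  refine ⟨(ε * ε)⁻¹, fun E => ?_⟩
  have h := trace_mul_kron_le (posSemidef_of_mem_productTests E)
    (posSemidef_real_smul PosSemidef.one hε.le) (U.posSemidef_mu n) hmu hmu
  have h1 := E.2.2.2
  rw [real_smul_eq, kron_smul_smul, kron_one_one, Matrix.mul_smul, mul_one, trace_smul,
    smul_eq_mul, ← Complex.ofReal_mul, Complex.re_ofReal_mul] at h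
  rw [← one_div, le_div_iff₀' (by positivity)]
  exact h.trans h1

theorem summable_lowerM_toReal (U : PrefixMachine) (n : ℕ) :
    Summable fun E : U.ProductTests (U.mu n) (U.mu n) => (U.lowerM E.1 (natStr n)).toReal :=
  ENNReal.summable_toReal
    (ne_top_of_le_ne_top ENNReal.one_ne_top (U.tsum_lowerM_le_one (natStr n) _))

theorem tsum_lowerM_toReal_le_one (U : PrefixMachine) (n : ℕ) :
    ∑' E : U.ProductTests (U.mu n) (U.mu n), (U.lowerM E.1 (natStr n)).toReal ≤ 1 := by
  have h := U.tsum_lowerM_le_one (natStr n) (U.ProductTests (U.mu n) (U.mu n))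
  rw [← ENNReal.tsum_toReal_eq fun E => ne_top_of_le_ne_top ENNReal.one_ne_top
    ((ENNReal.le_tsum E).trans h)]
  exact ENNReal.toReal_le_of_le_ofReal zero_le_one (by simpa using h)

theorem IsUniversal.summable_testTerm {U : PrefixMachine} (hU : U.IsUniversal) (n : ℕ) :
    Summable (U.testTerm n) := by
  obtain ⟨B, hB⟩ := hU.exists_trace_test_le n
  refine summable_matrix ((U.summable_lowerM_toReal n).mul_right B) fun E i j => ?_
  rw [testTerm, Matrix.smul_apply, norm_smul, Real.norm_of_nonneg ENNReal.toReal_nonneg]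
  exact mul_le_mul_of_nonneg_left
    ((norm_apply_le_trace (posSemidef_of_mem_productTests E) i j).trans (hB E))
    ENNReal.toReal_nonneg

/-- The trace is continuous and additive, so the bound ab on each test can be summed against weights
of total at most 1. -/
theorem IsUniversal.trace_universalTest_le {U : PrefixMachine} (hU : U.IsUniversal) (n : ℕ)
    {ρ σ : Matrix (Fin (2 ^ n)) (Fin (2 ^ n)) ℂ} (hρ : ρ.PosSemidef) {a b : ℝ} (ha : 0 ≤ a)
    (hb : 0 ≤ b) (hρa : (a • U.mu n - ρ).PosSemidef) (hσb : (b • U.mu n - σ).PosSemidef) :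
    (U.universalTest n * kron ρ σ).trace.re ≤ a * b := by
  have hsum : HasSum (fun E => (U.testTerm n E * kron ρ σ).trace.re)
      (U.universalTest n * kron ρ σ).trace.re := by
    let f : Matrix (Fin (2 ^ n * 2 ^ n)) (Fin (2 ^ n * 2 ^ n)) ℂ →+ ℝ :=
      { toFun := fun X => (X * kron ρ σ).trace.re
        map_zero' := by simp
        map_add' := fun X Y => by rw [add_mul, trace_add, Complex.add_re] }
    exact (hU.summable_testTerm n).hasSum.map f (show Continuous fun X :
      Matrix (Fin (2 ^ n * 2 ^ n)) (Fin (2 ^ n * 2 ^ n)) ℂ => (X * kron ρ σ).trace.re by fun_prop)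
  have hbound : ∀ E : U.ProductTests (U.mu n) (U.mu n), (U.testTerm n E * kron ρ σ).trace.re ≤
      (U.lowerM E.1 (natStr n)).toReal * (a * b) := fun E => by
    have h := trace_mul_kron_le (posSemidef_of_mem_productTests E) hρ
      (posSemidef_real_smul (U.posSemidef_mu n) hb) hρa hσb
    rw [real_smul_eq, real_smul_eq, kron_smul_smul, Matrix.mul_smul, trace_smul, smul_eq_mul,
      ← Complex.ofReal_mul, Complex.re_ofReal_mul] at h
    rw [testTerm, real_smul_eq, Matrix.smul_mul, trace_smul, smul_eq_mul, Complex.re_ofReal_mul]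
    exact mul_le_mul_of_nonneg_left
      (h.trans (mul_le_of_le_one_right (mul_nonneg ha hb) E.2.2.2)) ENNReal.toReal_nonneg
  refine (hasSum_le hbound hsum ((U.summable_lowerM_toReal n).mul_right (a * b)).hasSum).trans ?_
  rw [tsum_mul_right]
  exact mul_le_of_le_one_left (mul_nonneg ha hb) (U.tsum_lowerM_toReal_le_one n)

end PrefixMachine

theorem log2_le_of_le_two_pow {x : ℝ} {k : ℕ} (h : x ≤ 2 ^ k) : log2 x ≤ ((k : ℝ) : EReal) := by
  rw [log2]
  split_ifs with hx
  · exact bot_le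
  · rw [EReal.coe_le_coe_iff, Real.logb_le_iff_le_rpow (by norm_num) (not_le.1 hx),
      Real.rpow_natCast]
    exact h

end

theorem theorem6 (U : PrefixMachine) (hU : U.IsUniversal) :
    (∀ n : ℕ, Summable (U.muTerm n)) ∧
    (∀ n : ℕ, Summable (U.testTerm n)) ∧
    ∃ c : ℝ, ∀ (n : ℕ) (ρ σ : Matrix (Fin (2 ^ n)) (Fin (2 ^ n)) GaussRat),
      IsSemiDensity (toC ρ) → IsSemiDensity (toC σ) →
        U.I n (toC ρ) (toC σ) ≤
          ((U.K (matStr ρ) (natStr n) : ℝ≥0∞) : EReal) +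
            ((U.K (matStr σ) (natStr n) : ℝ≥0∞) : EReal) + ((c : ℝ) : EReal) := by
  obtain ⟨c, hc⟩ := hU.exists_mu_dominates
  refine ⟨U.summable_muTerm, hU.summable_testTerm, ((2 * c + 11 : ℕ) : ℝ),
    fun n ρ σ hρ hσ => ?_⟩
  obtain ⟨k, hk⟩ := ENat.ne_top_iff_exists.1 (hU.K_ne_top (matStr ρ) (natStr n))
  obtain ⟨l, hl⟩ := ENat.ne_top_iff_exists.1 (hU.K_ne_top (matStr σ) (natStr n))
  have h := hU.trace_universalTest_le n hρ.1 (by positivity) (by positivity)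
    (hc n ρ hρ k hk.symm) (hc n σ hσ l hl.symm)
  -- The two factors 40 give 1600 ≤ 2048 = 2^11, whence the constant 2c + 11.
  have hpow : (40 * 2 ^ (k + c) : ℝ) * (40 * 2 ^ (l + c)) ≤ 2 ^ (k + l + (2 * c + 11)) := by
    have : (2 : ℝ) ^ (k + l + (2 * c + 11)) = 2 ^ (k + c) * 2 ^ (l + c) * 2048 := by
      rw [show k + l + (2 * c + 11) = (k + c) + (l + c) + 11 by ring, pow_add, pow_add]
      norm_num
    rw [this]
    nlinarith [show (0 : ℝ) < 2 ^ (k + c) * 2 ^ (l + c) by positivity]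
  refine (log2_le_of_le_two_pow (h.trans hpow)).trans (le_of_eq ?_)
  rw [← hk, ← hl]
  simp only [ENat.toENNReal_coe]
  have hcast : ∀ m : ℕ, ((m : ℝ≥0∞) : EReal) = ((m : ℝ) : EReal) := fun m => by
    rw [← ENNReal.coe_natCast, EReal.coe_nnreal_eq_coe_real, NNReal.coe_natCast]
  rw [hcast, hcast, ← EReal.coe_add, ← EReal.coe_add]
  push_cast
  rfl
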